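/- Fix integers $l_1,l_2\ge 1$ and put $n=l_1l_2$. Circuits are sequences of layers. A layer is a set of one-qubit and two-qubit unitary gates (arbitrary unitaries) that act on pairwise disjoint sets of qubits, and the depth of a circuit is its number of layers. A circuit is constrained to a graph $G$ on its qubits if each of its two-qubit gates acts on two qubits that are adjacent in $G$. Let $G_v$ be the graph on $n+1$ qubits that consists of the $l_1\times l_2$ lattice (the grid graph on $n$ qubits) and one further qubit, the control qubit, joined only to one lattice site $v$. There is a universal constant $K$ such that the following holds for all $l_1,l_2\ge 1$, all $d\ge 0$, all lattice sites $v$, and every circuit $\mathcal C$ of depth $d$ on the $n$ lattice qubits, whose two-qubit gates may act on arbitrary pairs of qubits. Let $\mathbf U$ be the unitary of $\mathcal C$. 1. There is a circuit on the $n+1$ qubits, constrained to $G_v$ and of depth at most $K\,d\,(l_1+l_2)$, that implements exactly the controlled unitary $|0\rangle\langle 0|\otimes \mathbf I+|1\rangle\langle 1|\otimes \mathbf U$, where the first factor is the control qubit. 2. If $d\ge 1$, then for each $j\in\{0,1\}$ there is a circuit on the $n+1$ qubits, constrained to $G_v$ and of depth at most $K\,d\,(l_1+l_2)$, that implements exactly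 the Hadamard test $$(H\otimes \mathbf I)\,(S^{j}\otimes \mathbf I)\,\bigl(|0\rangle\langle 0|\otimes \mathbf I+|1\rangle\langle 1|\otimes \mathbf U\bigr)\,(H\otimes \mathbf I),\qquad S=\mathrm{diag}(1,i).$$ Applied to $|0^{n+1}\rangle$ and followed by a measurement of the control qubit in the computational basis, it yields the outcome $0$ with probability $\tfrac12\bigl(1+\mathrm{Re}\,\langle 0^n|\mathbf U|0^n\rangle\bigr)$ for $j=0$ and $\tfrac12\bigl(1-\mathrm{Im}\,\langle 0^n|\mathbf U|0^n\rangle\bigr)$ for $j=1$. -/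

import Mathlib

open scoped Matrix

namespace QCircuit

section Basic

variable {Q : Type*} [Fintype Q] [DecidableEq Q]

/-- Computational basis states of a register whose qubits are indexed by `Q`
(`false` is `|0⟩`, `true` is `|1⟩`). -/
abbrev Basis (Q : Type*) : Type _ := Q → Bool

/-- Operators on the `2 ^ |Q|`-dimensional state space, in the computational basis. -/
abbrev Op (Q : Type*) : Type _ := Matrix (Basis Q) (Basis Q) ℂ

/-- The operator `u` applied to the qubit `q`, tensored with the identity on all other qubits. -/
def applyOne (q : Q) (u : Matrix Bool Bool ℂ) : Op Q := fun x y =>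
  if ∀ r, r ≠ q → x r = y r then u (x q) (y q) else 0

/-- The operator `u` applied to the qubits `p`, `q` (in this order), tensored with the identity on
all other qubits. -/
def applyTwo (p q : Q) (u : Matrix (Bool × Bool) (Bool × Bool) ℂ) : Op Q := fun x y =>
  if ∀ r, r ≠ p → r ≠ q → x r = y r then u (x p, x q) (y p, y q) else 0

/-- Gates: arbitrary unitaries on one qubit, or on two distinct qubits. -/
inductive Gate (Q : Type*) where
  | one (q : Q) (u : Matrix.unitaryGroup Bool ℂ) : Gate Q
  | two (p q : Q) (hpq : p ≠ q) (u : Matrix.unitaryGroup (Bool × Bool) ℂ) : Gate Q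

/-- The set of qubits on which a gate operates. -/
def Gate.support {Q : Type*} : Gate Q → Set Q
  | .one q _ => {q}
  | .two p q _ _ => {p, q}

/-- The operator of a gate on the whole register. -/
def Gate.op : Gate Q → Op Q
  | .one q u => applyOne q u
  | .two p q _ u => applyTwo p q u

/-- A gate respects the connectivity graph `G` if it is a one-qubit gate or a two-qubit gate on
two qubits that are adjacent in `G`. -/
def Gate.Under {Q : Type*} (G : SimpleGraph Q) : Gate Q → Prop
  | .one _ _ => True
  | .two p q _ _ => G.Adj p q

/-- A one-layer circuit: finitely many gates that operate on pairwise disjoint sets of qubits. -/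
structure Layer (Q : Type*) where
  gates : List (Gate Q)
  disjoint : gates.Pairwise fun g h => Disjoint g.support h.support

/-- The operator of a layer (its gates commute, so their order is irrelevant). -/
def Layer.op (L : Layer Q) : Op Q := (L.gates.map Gate.op).prod

/-- A circuit is a sequence of layers; the head of the list is performed first. -/
abbrev Circuit (Q : Type*) : Type _ := List (Layer Q)

/-- The depth of a circuit: the number of its layers. -/
def Circuit.depth {Q : Type*} (C : Circuit Q) : ℕ := List.length C

/-- The operator `C⁽ᵈ⁾ ⋯ C⁽²⁾ C⁽¹⁾` implemented by a circuit with layers `C⁽¹⁾, …, C⁽ᵈ⁾`. -/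
def Circuit.op (C : Circuit Q) : Op Q := (List.map Layer.op C).reverse.prod

/-- The circuit is constrained to the connectivity graph `G`. -/
def Circuit.Under {Q : Type*} (G : SimpleGraph Q) (C : Circuit Q) : Prop :=
  ∀ L ∈ C, ∀ g ∈ L.gates, g.Under G

/-! A register `Q` together with one further qubit, the control qubit, has the index type
`Option Q`: the control qubit is `none`, and the qubits of `Q` are `some q`. -/

/-- The controlled operator: the identity on `Q` if the control qubit is `|0⟩`, and `U` on `Q` if
it is `|1⟩`. -/
def controlled (U : Op Q) : Op (Option Q) := fun x y =>
  if x none = y none then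
    if x none = true then U (fun q => x (some q)) (fun q => y (some q))
    else if (fun q => x (some q)) = (fun q => y (some q)) then 1 else 0
  else 0

/-- The Hadamard gate. -/
noncomputable def gateH : Matrix Bool Bool ℂ := fun a b =>
  if a = true ∧ b = true then -((√2 : ℝ) : ℂ)⁻¹ else ((√2 : ℝ) : ℂ)⁻¹

/-- The phase gate `diag (1, i)`. -/
noncomputable def gateS : Matrix Bool Bool ℂ :=
  Matrix.diagonal fun a => if a = true then Complex.I else 1

/-- The operator of the Hadamard test circuit: `H` on the control qubit, then controlled `U`, then
`S ^ j` and `H` on the control qubit. -/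
noncomputable def hadamardTest (U : Op Q) (j : ℕ) : Op (Option Q) :=
  applyOne none gateH * applyOne none (gateS ^ j) * controlled U * applyOne none gateH

/-- The all-zero basis state `|0 ⋯ 0⟩`. -/
def zeroState (Q : Type*) : Basis Q := fun _ => false

/-- The probability of the outcome `0` when `W` is applied to `|0 ⋯ 0⟩` and the control qubit is
then measured in the computational basis. -/
noncomputable def probZero (W : Op (Option Q)) : ℝ :=
  ∑ x : Basis (Option Q), if x none = false then ‖W x (zeroState (Option Q))‖ ^ 2 else 0

end Basic

/-- The `l₁ × l₂` lattice: sites are adjacent when they are at unit distance in one coordinate and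
agree in the other one. -/
def lattice (l₁ l₂ : ℕ) : SimpleGraph (Fin l₁ × Fin l₂) :=
  SimpleGraph.boxProd (SimpleGraph.pathGraph l₁) (SimpleGraph.pathGraph l₂)

/-- The graph `G` with one more vertex, the control qubit, which is joined to the single
vertex `v`. -/
def withControl {Q : Type*} (G : SimpleGraph Q) (v : Q) : SimpleGraph (Option Q) :=
  G.map some ⊔ SimpleGraph.edge none (some v)

end QCircuit

/-! Only those factors of a product need a control whose removal collapses the product to the
identity. If `A * B = 1`, then `A * U * B` is controlled by controlling `U` alone
(`controlled_conj`). Likewise, an alternating product of operators and `X` that becomes `1` when the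
`X`s are deleted is controlled by controlling the `X`s alone (`controlled_interleaved`). This
reduces everything to one controlled operator, the negation X^⊗n of all qubits.

Every one- or two-qubit unitary is, up to a phase, such an alternating product with four local
negations: it is diagonalized, and its diagonal part is written with commutators of diagonal
unitaries and the negation (`interleaved_one`, `interleaved_two`). Conjugation by X^⊗n acts on each
gate as its local negation, so the same four global negations serve all gates of a layer at once
(`Layer.exists_interleaved`). The phases become a one-qubit gate on the control qubit.

For controlled X^⊗n, CNOTs spread from `v` over the lattice: they form a circuit `B` of depth O(l₁ +
l₂) with `B` X_v `B`* = X^⊗n (`lattice_spreads`). Only X_v is then controlled, by a single CNOT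
(`implements_controlled_allX`).

A layer with distant pairs is conjugated by an uncontrolled permutation of the sites that makes
partners adjacent along a snake (`Layer.exists_perm_under_lattice`). Permutations cost O(l₁ + l₂)
layers of SWAPs: Hall's theorem splits them into column, row and column permutations
(`exists_column_row_column`), and a path is permuted in linear depth by pipelined insertion
(`path_swapSteps`). Each layer of the given circuit thus costs O(l₁ + l₂). -/

set_option linter.unusedSectionVars false

namespace QCircuit

/-! ### Diagonalization of unitary matrices by the Cayley transform -/

section Unitary

variable {ι : Type*} [Fintype ι] [DecidableEq ι]

/-- Every unitary matrix is diagonalized by a unitary matrix. -/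
theorem exists_unitary_diagonal (u : Matrix.unitaryGroup ι ℂ) :
    ∃ (V : Matrix.unitaryGroup ι ℂ) (a : ι → Circle), (u : Matrix ι ι ℂ) =
      (V : Matrix ι ι ℂ) * Matrix.diagonal (fun i => (a i : ℂ)) * star (V : Matrix ι ι ℂ) := by
  have hfin : (spectrum ℂ (u : Matrix ι ι ℂ)).Finite := Matrix.finite_spectrum _
  have hinf : (Metric.sphere (0 : ℂ) 1).Infinite := by
    have : Infinite (Set.Ioo (0 : ℝ) 1) := (Set.Ioo_infinite one_pos).to_subtype
    apply Set.infinite_of_injective_forall_mem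
      (f := fun t : Set.Ioo (0 : ℝ) 1 => Complex.exp ((t : ℝ) * Complex.I))
    · rintro ⟨s, hs⟩ ⟨t, ht⟩ h
      have hpi := Real.pi_gt_three
      have h' := congrArg Complex.arg h
      simp only [Complex.arg_exp_mul_I] at h'
      rw [(toIocMod_eq_self _).2, (toIocMod_eq_self _).2] at h'
      · exact Subtype.ext h'
      · constructor <;> linarith [ht.1, ht.2]
      · constructor <;> linarith [hs.1, hs.2]
    · intro t
      simp [Complex.norm_exp_ofReal_mul_I]
  -- The unit circle is infinite and the spectrum finite, so some `c` of modulus one makes `c - M`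
  -- invertible.
  obtain ⟨c, hc, hcu⟩ := (hinf.sdiff hfin).nonempty
  have hc1 : star c * c = 1 := by
    have : ‖c‖ = 1 := by simpa using hc
    rw [Complex.star_def, ← Complex.normSq_eq_conj_mul_self, Complex.normSq_eq_norm_sq, this]; simp
  have hU : star (u : Matrix ι ι ℂ) * (u : Matrix ι ι ℂ) = 1 := Unitary.star_mul_self_of_mem u.2
  have hU' : (u : Matrix ι ι ℂ) * star (u : Matrix ι ι ℂ) = 1 := Unitary.mul_star_self_of_mem u.2
  set M : Matrix ι ι ℂ := (u : Matrix ι ι ℂ) with hM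
  have hunit : IsUnit (algebraMap ℂ (Matrix ι ι ℂ) c - M) := by
    simpa [spectrum, resolventSet] using hcu
  obtain ⟨T, hT⟩ := hunit
  rw [Algebra.algebraMap_eq_smul_one] at hT
  -- the Cayley transform
  set N : Matrix ι ι ℂ := ((T⁻¹ : (Matrix ι ι ℂ)ˣ) : Matrix ι ι ℂ) with hN
  have hTN : (T : Matrix ι ι ℂ) * N = 1 := T.mul_inv
  have hNT : N * (T : Matrix ι ι ℂ) = 1 := T.inv_mul
  have hTM : (T : Matrix ι ι ℂ) * (c • 1 + M) = (c • 1 + M) * T := by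
    rw [hT]; simp only [mul_add, add_mul, sub_mul, mul_sub, smul_mul_assoc, mul_smul_comm, one_mul, mul_one]
    module
  have hNM : N * (c • 1 + M) = (c • 1 + M) * N := by
    calc N * (c • 1 + M) = N * ((c • 1 + M) * T) * N := by
          rw [mul_assoc, mul_assoc, hTN, mul_one]
      _ = _ := by rw [← hTM, ← mul_assoc, hNT, one_mul]
  have hstarT : star (T : Matrix ι ι ℂ) = -(star c) • (star M * T) := by
    rw [hT, star_sub, star_smul, star_one, mul_sub, hU, smul_sub]
    simp only [mul_smul_comm, mul_one, smul_smul, neg_mul, hc1]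
    module
  have hstarP : star (c • 1 + M : Matrix ι ι ℂ) = (star c) • (star M * (c • 1 + M)) := by
    rw [star_add, star_smul, star_one, mul_add, hU, smul_add]
    simp only [mul_smul_comm, mul_one, smul_smul, hc1, one_smul]
    abel
  set A : Matrix ι ι ℂ := Complex.I • ((c • 1 + M) * N) with hA
  have hAT : A * T = Complex.I • (c • 1 + M) := by
    rw [hA, smul_mul_assoc, mul_assoc, hNT, mul_one]
  have hherm : A.IsHermitian := by
    have h1 : star (T : Matrix ι ι ℂ) * star A = star (T : Matrix ι ι ℂ) * A := by
      rw [← star_mul, hAT, star_smul, hstarP, hstarT, hA]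
      rw [← hNM]
      simp only [smul_mul_assoc, mul_smul_comm, mul_assoc, smul_smul]
      rw [← mul_assoc (T : Matrix ι ι ℂ) N, hTN, one_mul]
      simp
    have h2 : star N * star (T : Matrix ι ι ℂ) = 1 := by rw [← star_mul, hTN, star_one]
    calc star A = star N * (star (T : Matrix ι ι ℂ) * star A) := by rw [← mul_assoc, h2, one_mul]
      _ = A := by rw [h1, ← mul_assoc, h2, one_mul]
  set V := hherm.eigenvectorUnitary with hV
  have hspec : star (V : Matrix ι ι ℂ) * A * (V : Matrix ι ι ℂ)
      = Matrix.diagonal (RCLike.ofReal ∘ hherm.eigenvalues) := by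
    have := hherm.spectral_theorem
    rw [Unitary.conjStarAlgAut_apply] at this
    conv_lhs => rw [this]
    have hVV : star (V : Matrix ι ι ℂ) * (V : Matrix ι ι ℂ) = 1 := Unitary.star_mul_self_of_mem V.2
    simp only [← hV, mul_assoc, hVV, mul_one]
    rw [← mul_assoc, hVV, one_mul]
  have hVV : star (V : Matrix ι ι ℂ) * (V : Matrix ι ι ℂ) = 1 := Unitary.star_mul_self_of_mem V.2
  have hVV' : (V : Matrix ι ι ℂ) * star (V : Matrix ι ι ℂ) = 1 := Unitary.mul_star_self_of_mem V.2
  set D : Matrix ι ι ℂ := star (V : Matrix ι ι ℂ) * M * V with hD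
  set l : ι → ℝ := hherm.eigenvalues with hl
  -- In an eigenbasis of the Hermitian `A` = i(c + M)(c - M)⁻¹ the Cayley relation reads lᵢ(c - D) =
  -- i(c + D). Off the diagonal this is (lᵢ + i)Dᵢⱼ = 0, and lᵢ is real, so `D` is diagonal.
  have hkey : Matrix.diagonal (RCLike.ofReal ∘ l) * (c • 1 - D) = Complex.I • (c • 1 + D) := by
    have h0 : star (V : Matrix ι ι ℂ) * (A * T) * V
        = Complex.I • (star (V : Matrix ι ι ℂ) * (c • 1 + M) * V) := by
      rw [hAT, mul_smul_comm, smul_mul_assoc]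
    have h1 : star (V : Matrix ι ι ℂ) * (c • 1 + M) * V = c • 1 + D := by
      simp [mul_add, add_mul, hVV, hD]
    have h2 : star (V : Matrix ι ι ℂ) * T * V = c • 1 - D := by
      rw [hT]; simp [mul_sub, sub_mul, hVV, hD]
    rw [← hspec, ← h1, ← h2, ← h0]
    simp only [mul_assoc]
    rw [← mul_assoc (V : Matrix ι ι ℂ) (star _), hVV', one_mul]
  have hdiag : D = Matrix.diagonal fun i => D i i := by
    ext i j
    by_cases hij : i = j
    · subst hij; simp
    · have h := congrFun (congrFun hkey i) j
      simp only [Matrix.diagonal_mul, Matrix.sub_apply, Matrix.smul_apply, Matrix.add_apply,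
        Matrix.one_apply_ne hij, Function.comp] at h
      rw [Matrix.diagonal_apply_ne _ hij]
      have h3 : ((l i : ℂ) + Complex.I) * D i j = 0 := by
        simp only [smul_eq_mul, mul_zero, zero_sub, zero_add] at h
        have h' : (l i : ℂ) * -D i j = Complex.I * D i j := h
        linear_combination -h'
      rcases mul_eq_zero.1 h3 with h4 | h4
      · have := congrArg Complex.im h4
        simp at this
      · exact h4
  have hDD : star D * D = 1 := by
    rw [hD, star_mul, star_mul, star_star]
    calc _ = star (V : Matrix ι ι ℂ) * (star M * ((V : Matrix ι ι ℂ) * star (V : Matrix ι ι ℂ)) * M)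
          * (V : Matrix ι ι ℂ) := by simp only [mul_assoc]
      _ = 1 := by rw [hVV', mul_one, hU, mul_one, hVV]
  have hnorm : ∀ i, D i i ∈ Submonoid.unitSphere ℂ := by
    intro i
    have h := congrFun (congrFun hDD i) i
    rw [hdiag] at h
    simp only [Matrix.star_eq_conjTranspose, Matrix.diagonal_conjTranspose,
      Matrix.diagonal_mul_diagonal, Matrix.diagonal_apply_eq, Matrix.one_apply_eq, Pi.star_apply,
      Complex.star_def, ← Complex.normSq_eq_conj_mul_self, Complex.normSq_eq_norm_sq] at h
    have h' : ‖D i i‖ ^ 2 = 1 := by exact_mod_cast h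
    exact mem_sphere_zero_iff_norm.2 <| (pow_eq_one_iff_of_nonneg (norm_nonneg _) two_ne_zero).1 h'
  refine ⟨V, fun i => ⟨D i i, hnorm i⟩, ?_⟩
  change _ = _ * (Matrix.diagonal fun i => D i i) * _
  rw [← hdiag, hD]
  simp only [mul_assoc, hVV', mul_one]
  rw [← mul_assoc, hVV', one_mul]

end Unitary

/-! ### Unitaries as alternating products with a negation -/

section PermMat

variable {ι : Type*} [Fintype ι] [DecidableEq ι]

/-- The permutation matrix that maps the basis vector `j` to the basis vector `φ j`. -/
def permMat (φ : Equiv.Perm ι) : Matrix ι ι ℂ := fun i j => if i = φ j then 1 else 0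

theorem permMat_mul_apply (φ : Equiv.Perm ι) (A : Matrix ι ι ℂ) (i j : ι) :
    (permMat φ * A) i j = A (φ⁻¹ i) j := by
  rw [Matrix.mul_apply, Finset.sum_eq_single (φ⁻¹ i)]
  · simp [permMat]
  · intro k _ hk
    have : i ≠ φ k := fun h => hk (by simp [h])
    simp [permMat, this]
  · simp

theorem mul_permMat_apply (φ : Equiv.Perm ι) (A : Matrix ι ι ℂ) (i j : ι) :
    (A * permMat φ) i j = A i (φ j) := by
  rw [Matrix.mul_apply, Finset.sum_eq_single (φ j)]
  · simp [permMat]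
  · intro k _ hk
    simp [permMat, hk]
  · simp

@[simp] theorem permMat_one : permMat (1 : Equiv.Perm ι) = 1 := by
  ext i j; by_cases h : i = j <;> simp [permMat, h, Matrix.one_apply]

theorem permMat_mul (φ ψ : Equiv.Perm ι) : permMat (φ * ψ) = permMat φ * permMat ψ := by
  ext i j; rw [mul_permMat_apply]; by_cases h : i = φ (ψ j) <;> simp [permMat, h]

theorem permMat_mul_inv (φ : Equiv.Perm ι) : permMat φ * permMat φ⁻¹ = 1 := by
  rw [← permMat_mul, mul_inv_cancel, permMat_one]

theorem star_permMat (φ : Equiv.Perm ι) : star (permMat φ) = permMat φ⁻¹ := by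
  ext i j
  simp only [Matrix.star_apply, permMat, Equiv.Perm.eq_inv_iff_eq]
  simp only [eq_comm, apply_ite star, star_one, star_zero]

/-- A permutation matrix as a unitary. -/
def permUnitary (φ : Equiv.Perm ι) : Matrix.unitaryGroup ι ℂ :=
  ⟨permMat φ, by rw [Matrix.mem_unitaryGroup_iff, star_permMat, permMat_mul_inv]⟩

/-- A diagonal unitary. -/
noncomputable def diagUnitary (a : ι → Circle) : Matrix.unitaryGroup ι ℂ :=
  ⟨Matrix.diagonal fun i => (a i : ℂ), by
    rw [Matrix.mem_unitaryGroup_iff, Matrix.star_eq_conjTranspose, Matrix.diagonal_conjTranspose,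
      Matrix.diagonal_mul_diagonal, ← Matrix.diagonal_one]
    congr 1; funext i
    rw [Pi.star_apply, Complex.star_def, Complex.mul_conj, Circle.normSq_coe]; simp⟩

theorem permMat_conj_diagonal (φ : Equiv.Perm ι) (a : ι → ℂ) :
    permMat φ * Matrix.diagonal a * permMat φ⁻¹ = Matrix.diagonal (a ∘ ⇑φ⁻¹) := by
  ext i j
  rw [mul_permMat_apply, permMat_mul_apply]
  simp [Matrix.diagonal_apply]

theorem star_diagUnitary (a : ι → Circle) : star (diagUnitary a) = diagUnitary a⁻¹ := by
  apply Subtype.ext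
  simp only [Unitary.coe_star, diagUnitary, Matrix.star_eq_conjTranspose,
    Matrix.diagonal_conjTranspose]
  congr 1; funext i
  simp [← Circle.coe_inv_eq_conj]

theorem diagUnitary_commutator {φ : Equiv.Perm ι} (hφ : φ⁻¹ = φ) (r : ι → Circle) :
    (diagUnitary r : Matrix ι ι ℂ) * (permMat φ * (star (diagUnitary r) : Matrix.unitaryGroup ι ℂ)
      * permMat φ) = diagUnitary fun i => r i / r (φ i) := by
  rw [star_diagUnitary]
  have := permMat_conj_diagonal φ fun i => ((r⁻¹ i : Circle) : ℂ)
  rw [hφ] at this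
  simp only [diagUnitary]
  rw [this, Matrix.diagonal_mul_diagonal]
  simp [div_eq_mul_inv]

/-- `u` is, up to a phase, an alternating product of unitaries and the involution `χ` which
collapses to the identity when `χ` is omitted. -/
def Interleaved (χ : Matrix ι ι ℂ) (u : Matrix ι ι ℂ) : Prop :=
  ∃ (z : Circle) (a : Fin 5 → Matrix.unitaryGroup ι ℂ),
    u = (z : ℂ) • ((a 0 : Matrix ι ι ℂ) * (χ * a 1 * χ) * a 2 * (χ * a 3 * χ) * a 4) ∧
    (a 0 : Matrix ι ι ℂ) * a 1 * a 2 * a 3 * a 4 = 1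

/-- After diagonalization, the hypothesis splits the eigenvalues into a phase, a commutator of
`diagUnitary r` with `φ`, and a `π`-conjugate of such a commutator for `t`. Deleting `φ` trivializes
both commutators, after which π² = 1 and `V` cancels its adjoint. -/
theorem interleaved_of_diagonal {φ π : Equiv.Perm ι} (hφ : φ⁻¹ = φ) (hπ : π⁻¹ = π)
    (u : Matrix.unitaryGroup ι ℂ)
    (h : ∀ a : ι → Circle, ∃ (z : Circle) (r t : ι → Circle),
      ∀ i, a i = z * ((r i / r (φ i)) * (t (π i) / t (φ (π i))))) :
    Interleaved (permMat φ) (u : Matrix ι ι ℂ) := by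
  obtain ⟨V, a, hu⟩ := exists_unitary_diagonal u
  obtain ⟨z, r, t, ha⟩ := h a
  have hVV : (V : Matrix ι ι ℂ) * star (V : Matrix ι ι ℂ) = 1 := Unitary.mul_star_self_of_mem V.2
  have hππ : permMat π * permMat π = 1 := by
    have := permMat_mul_inv π
    rwa [hπ] at this
  refine ⟨z, ![V * diagUnitary r, star (diagUnitary r), permUnitary π * diagUnitary t,
    star (diagUnitary t), permUnitary π * star V], ?_, ?_⟩
  · have hr := diagUnitary_commutator hφ r
    have ht := diagUnitary_commutator hφ t
    have hD : Matrix.diagonal (fun i => (a i : ℂ)) = (z : ℂ) •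
        (((diagUnitary fun i => r i / r (φ i)) : Matrix ι ι ℂ) * (permMat π *
          ((diagUnitary fun i => t i / t (φ i)) : Matrix ι ι ℂ) * permMat π)) := by
      simp only [diagUnitary]
      have := permMat_conj_diagonal π fun i => ((t i / t (φ i) : Circle) : ℂ)
      rw [hπ] at this
      rw [this, Matrix.diagonal_mul_diagonal, ← Matrix.diagonal_smul]
      congr 1; funext i
      rw [ha i]
      simp
    rw [hu, hD, ← hr, ← ht]
    simp [permUnitary, mul_assoc]
  · simp only [Matrix.cons_val]
    have hrr : (diagUnitary r : Matrix ι ι ℂ) * star (diagUnitary r : Matrix ι ι ℂ) = 1 :=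
      Unitary.mul_star_self_of_mem (diagUnitary r).2
    have htt : (diagUnitary t : Matrix ι ι ℂ) * star (diagUnitary t : Matrix ι ι ℂ) = 1 :=
      Unitary.mul_star_self_of_mem (diagUnitary t).2
    calc _ = (V : Matrix ι ι ℂ) * ((diagUnitary r : Matrix ι ι ℂ) *
          star (diagUnitary r : Matrix ι ι ℂ)) * (permMat π * ((diagUnitary t : Matrix ι ι ℂ) *
          star (diagUnitary t : Matrix ι ι ℂ)) * permMat π) * star (V : Matrix ι ι ℂ) := by
          simp [permUnitary, mul_assoc]
      _ = 1 := by rw [hrr, htt, mul_one, mul_one, hππ, mul_one, hVV]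

end PermMat

theorem exists_circle_pow_eq (w : Circle) {n : ℕ} (hn : n ≠ 0) : ∃ z : Circle, z ^ n = w := by
  refine ⟨Circle.exp (Complex.arg w / n), ?_⟩
  rw [← Circle.exp_nsmul, nsmul_eq_mul, mul_div_cancel₀ _ (by exact_mod_cast hn), Circle.exp_arg]

/-- Negation of a bit. -/
def flipBit : Equiv.Perm Bool := Equiv.boolNot

/-- Negation of two bits. -/
def flipTwo : Equiv.Perm (Bool × Bool) := Equiv.prodCongr flipBit flipBit

theorem interleaved_one (u : Matrix.unitaryGroup Bool ℂ) :
    Interleaved (permMat flipBit) (u : Matrix Bool Bool ℂ) := by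
  refine interleaved_of_diagonal (π := 1) rfl rfl u fun a => ?_
  obtain ⟨z, hz⟩ := exists_circle_pow_eq (a false * a true) two_ne_zero
  -- Once `z` takes out a square root of the determinant, the two eigenvalues are inverse to each
  -- other, so one commutator is enough.
  refine ⟨z, fun i => if i then 1 else a false / z, 1, fun i => ?_⟩
  cases i
  · simp [flipBit]
  · simp [flipBit, ← pow_two, hz, mul_div_assoc']

theorem interleaved_two (u : Matrix.unitaryGroup (Bool × Bool) ℂ) :
    Interleaved (permMat flipTwo) (u : Matrix (Bool × Bool) (Bool × Bool) ℂ) := by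
  refine interleaved_of_diagonal (π := Equiv.swap (false, true) (true, true)) rfl
    (Equiv.swap_inv _ _) u fun a => ?_
  obtain ⟨z, hz⟩ := exists_circle_pow_eq
    (a (false, false) * a (false, true) * a (true, false) * a (true, true)) four_ne_zero
  set A := a (false, false) with hA
  set B := a (false, true) with hB
  set C := a (true, false) with hC
  set D := a (true, true) with hD
  -- Commutators with `flipTwo` are diagonals with inverse entries on the pairs {00, 11} and {01,
  -- 10}. With `z` a fourth root of the determinant, `r` makes the entries at 00 and 01 right.
  -- Conjugation by `π` changes the pairs to {00, 01} and {10, 11}, and `t` corrects the last two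
  -- entries, inversely to each other.
  refine ⟨z, fun i => if i.1 then 1 else (if i.2 then B / z else A / z),
    fun i => if i = (false, true) then (z ^ 2) / (B * C) else 1, ?_⟩
  have hD' : D = z ^ 4 / (A * B * C) := by rw [hz]; simp
  rintro ⟨_ | _, _ | _⟩
  · simp [flipTwo, flipBit, Equiv.swap_apply_def, ← hA]
  · simp [flipTwo, flipBit, ← hB]
  · have : (C : ℂ) = z * (z / B * ((B * C) / z ^ 2)) := by field_simp
    simp only [flipTwo, flipBit, Equiv.swap_apply_def, ← hC]
    apply Circle.ext
    simp
    field_simp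
  · simp only [flipTwo, flipBit, Equiv.swap_apply_def, ← hD, hD']
    apply Circle.ext
    simp
    field_simp

/-! ### Operators acting on a subset of the qubits -/

section Local

variable {Q : Type*} [Fintype Q] [DecidableEq Q] {T : Type*} [Fintype T] [DecidableEq T]

/-- A set of qubits together with a coordinate for its basis states. -/
structure Subsystem (Q T : Type*) where
  support : Set Q
  read : Basis Q → T
  write : T → Basis Q → Basis Q
  read_write : ∀ t x, read (write t x) = t
  write_off : ∀ t x, ∀ r ∉ support, write t x r = x r
  eq_of : ∀ x y, (∀ r ∉ support, x r = y r) → read x = read y → x = y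
  read_congr : ∀ x y, (∀ r ∈ support, x r = y r) → read x = read y

open Classical in
/-- An operator on a subsystem, tensored with the identity on the remaining qubits. -/
noncomputable def Subsystem.embed (s : Subsystem Q T) (u : Matrix T T ℂ) : Op Q := fun x y =>
  if ∀ r ∉ s.support, x r = y r then u (s.read x) (s.read y) else 0

/-- A single qubit as a subsystem. -/
def Subsystem.single (q : Q) : Subsystem Q Bool where
  support := {q}
  read x := x q
  write t x := Function.update x q t
  read_write t x := by simp
  write_off t x r hr := by simp at hr; simp [hr]
  eq_of x y h h' := by
    funext r
    by_cases hr : r = q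
    · rw [hr, h']
    · exact h r (by simpa using hr)
  read_congr x y h := h q (by simp)

/-- Two distinct qubits as a subsystem. -/
def Subsystem.pair (p q : Q) (hpq : p ≠ q) : Subsystem Q (Bool × Bool) where
  support := {p, q}
  read x := (x p, x q)
  write t x := Function.update (Function.update x p t.1) q t.2
  read_write t x := by simp [hpq]
  write_off t x r hr := by
    simp only [Set.mem_insert_iff, Set.mem_singleton_iff, not_or] at hr
    simp [hr.1, hr.2]
  eq_of x y h h' := by
    funext r
    by_cases hr : r ∈ ({p, q} : Set Q)
    · rcases hr with rfl | hr
      · exact congrArg Prod.fst h'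
      · rw [Set.mem_singleton_iff] at hr
        subst hr
        exact congrArg Prod.snd h'
    · exact h r hr
  read_congr x y h := by rw [h p (by simp), h q (by simp)]

theorem applyOne_eq_embed (q : Q) (u : Matrix Bool Bool ℂ) :
    applyOne q u = (Subsystem.single q).embed u := by
  funext x y
  simp only [applyOne, Subsystem.embed, Subsystem.single, Set.mem_singleton_iff]

theorem applyTwo_eq_embed (p q : Q) (hpq : p ≠ q) (u : Matrix (Bool × Bool) (Bool × Bool) ℂ) :
    applyTwo p q u = (Subsystem.pair p q hpq).embed u := by
  funext x y
  simp only [applyTwo, Subsystem.embed, Subsystem.pair, Set.mem_singleton_iff,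
    Set.mem_insert_iff, not_or, and_imp]

namespace Subsystem

variable (s : Subsystem Q T)

/-- An intermediate state contributes only if it agrees with `x` off the support. These states are
the `write t x`, so the sum over basis states becomes a sum over `T`. -/
theorem embed_mul (u w : Matrix T T ℂ) : s.embed (u * w) = s.embed u * s.embed w := by
  funext x y
  rw [Matrix.mul_apply]
  have h : ∑ t : T, s.embed u x (s.write t x) * s.embed w (s.write t x) y
      = ∑ k, s.embed u x k * s.embed w k y := by
    apply Finset.sum_of_injOn (fun t => s.write t x)
    · intro t _ t' _ h
      have := congrArg s.read h
      simpa only [s.read_write] using this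
    · simp
    · intro k _ hk
      rw [embed, if_neg, zero_mul]
      intro hxk
      apply hk
      refine ⟨s.read k, by simp, ?_⟩
      apply s.eq_of _ _ _ (s.read_write _ _)
      intro r hr
      rw [s.write_off _ _ r hr, hxk r hr]
    · simp
  rw [← h]
  by_cases hxy : ∀ r ∉ s.support, x r = y r
  · rw [embed, if_pos hxy, Matrix.mul_apply]
    refine Finset.sum_congr rfl fun t _ => ?_
    rw [embed, if_pos fun r hr => (s.write_off t x r hr).symm, embed, if_pos, s.read_write]
    intro r hr
    rw [s.write_off t x r hr, hxy r hr]
  · rw [embed, if_neg hxy, Finset.sum_eq_zero]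
    intro t _
    rw [embed, embed, if_neg (c := ∀ r ∉ s.support, s.write t x r = y r), mul_zero]
    intro h
    exact hxy fun r hr => by rw [← h r hr, s.write_off t x r hr]

theorem embed_smul (z : ℂ) (u : Matrix T T ℂ) : s.embed (z • u) = z • s.embed u := by
  funext x y
  simp [embed]

theorem embed_star (u : Matrix T T ℂ) : s.embed (star u) = star (s.embed u) := by
  funext x y
  rw [Matrix.star_apply, embed, embed]
  by_cases h : ∀ r ∉ s.support, x r = y r
  · rw [if_pos h, if_pos fun r hr => (h r hr).symm, Matrix.star_apply]
  · rw [if_neg h, if_neg fun h' => h fun r hr => (h' r hr).symm, star_zero]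

theorem embed_permMat (φ : Equiv.Perm T) (Φ : Equiv.Perm (Basis Q))
    (h : ∀ y, Φ y = s.write (φ (s.read y)) y) : s.embed (permMat φ) = permMat Φ := by
  funext x y
  simp only [embed, permMat, h]
  by_cases hx : x = s.write (φ (s.read y)) y
  · rw [if_pos hx, if_pos, if_pos]
    · rw [hx, s.read_write]
    · intro r hr
      rw [hx, s.write_off _ _ r hr]
  · rw [if_neg hx]
    split_ifs with h1 h2
    · exact absurd (s.eq_of _ _ (fun r hr => by rw [h1 r hr, s.write_off _ _ r hr])
        (by rw [h2, s.read_write])) hx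
    · rfl
    · rfl

theorem embed_one : s.embed (1 : Matrix T T ℂ) = 1 := by
  rw [← permMat_one, embed_permMat s 1 1, permMat_one]
  intro y
  exact s.eq_of _ _ (fun r hr => (s.write_off _ _ r hr).symm) (s.read_write _ _).symm

end Subsystem

/-- The operator `A` acts only on the qubits in `S`. -/
def Supported (S : Set Q) (A : Op Q) : Prop :=
  (∀ x y, ¬ (∀ r ∉ S, x r = y r) → A x y = 0) ∧
  ∀ x y x' y', (∀ r ∉ S, x r = y r) → (∀ r ∉ S, x' r = y' r) →
    (∀ r ∈ S, x r = x' r) → (∀ r ∈ S, y r = y' r) → A x y = A x' y'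

theorem Subsystem.supported_embed (s : Subsystem Q T) (u : Matrix T T ℂ) :
    Supported s.support (s.embed u) := by
  refine ⟨fun x y h => by rw [embed, if_neg h], fun x y x' y' h h' hx hy => ?_⟩
  rw [embed, embed, if_pos h, if_pos h', s.read_congr _ _ hx, s.read_congr _ _ hy]

open Classical in
-- A contributing intermediate state equals `x` off `S`, and equals `y` off `T`, hence on `S`; so
-- there is just one.
theorem Supported.mul_apply {S T : Set Q} {A B : Op Q} (hST : Disjoint S T) (hA : Supported S A)
    (hB : Supported T B) (x y : Basis Q) :
    (A * B) x y = A x (fun r => if r ∈ S then y r else x r)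
      * B (fun r => if r ∈ S then y r else x r) y := by
  rw [Matrix.mul_apply, Finset.sum_eq_single]
  · intro w _ hw
    by_cases h1 : ∀ r ∉ S, x r = w r
    · by_cases h2 : ∀ r ∉ T, w r = y r
      · exfalso
        apply hw
        funext r
        split_ifs with hr
        · exact h2 r (Set.disjoint_left.1 hST hr)
        · exact (h1 r hr).symm
      · rw [hB.1 _ _ h2, mul_zero]
    · rw [hA.1 _ _ h1, zero_mul]
  · simp

theorem Supported.commute {S T : Set Q} {A B : Op Q} (hST : Disjoint S T) (hA : Supported S A)
    (hB : Supported T B) : Commute A B := by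
  classical
  funext x y
  rw [hA.mul_apply hST hB, hB.mul_apply hST.symm hA]
  by_cases hxy : ∀ r, r ∉ S → r ∉ T → x r = y r
  · have hS := Set.disjoint_left.1 hST
    have hT := Set.disjoint_right.1 hST
    rw [mul_comm]
    congr 1
    · apply hB.2 <;> intro r hr
      · split_ifs with h
        · rfl
        · exact hxy r h hr
      · simp [hr]
      · simp [hT hr]
      · simp [hr]
    · apply hA.2 <;> intro r hr
      · simp [hr]
      · split_ifs with h
        · rfl
        · exact hxy r hr h
      · simp [hS hr]
      · simp [hr]
  · push Not at hxy
    obtain ⟨r, hrS, hrT, hr⟩ := hxy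
    rw [hB.1 _ y, hA.1 _ y]
    · simp
    · intro h
      exact hr (by simpa [hrT] using h r hrS)
    · intro h
      exact hr (by simpa [hrS] using h r hrT)

theorem Supported.mul {S : Set Q} {A B : Op Q} (hA : Supported S A) (hB : Supported S B) :
    Supported S (A * B) := by
  classical
  constructor
  · intro x y h
    rw [Matrix.mul_apply, Finset.sum_eq_zero]
    intro w _
    by_cases h1 : ∀ r ∉ S, x r = w r
    · rw [hB.1, mul_zero]
      exact fun h2 => h fun r hr => (h1 r hr).trans (h2 r hr)
    · rw [hA.1 _ _ h1, zero_mul]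
  · intro x y x' y' h h' hx hy
    rw [Matrix.mul_apply, Matrix.mul_apply]
    -- exchange the parts of the summation index outside `S`
    have key : ∀ a b : Basis Q, (∀ r ∉ S, a r = b r) → ∀ w,
        A a w * B w b ≠ 0 → w = fun r => if r ∈ S then w r else a r := by
      intro a b _ w hw
      funext r
      split_ifs with hr
      · rfl
      · by_contra hne
        exact hw (by rw [hA.1 a w fun h => hne (h r hr).symm, zero_mul])
    refine Finset.sum_bij_ne_zero (fun w _ _ => fun r => if r ∈ S then w r else x' r)
      (by simp) ?_ ?_ ?_
    · intro w _ hw v _ hv hwv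
      rw [key x y h w hw, key x y h v hv]
      funext r
      have := congrFun hwv r
      split_ifs with hr
      · simpa [hr] using this
      · rfl
    · intro w _ hw
      have e : w = fun r => if r ∈ S then (if r ∈ S then w r else x r) else x' r := by
        rw [key x' y' h' w hw]
        funext r
        by_cases hr : r ∈ S <;> simp [hr]
      refine ⟨fun r => if r ∈ S then w r else x r, by simp, ?_, e.symm⟩
      have hw' := hw
      rw [e] at hw'
      convert hw' using 2
      · apply hA.2 <;> intro r hr <;> simp [hr, hx]
      · apply hB.2 <;> intro r hr <;> simp [hr, hy, h, h']
    · intro w _ hw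
      rw [key x y h w hw]
      congr 1
      · apply hA.2 <;> intro r hr <;> simp [hr, hx]
      · apply hB.2 <;> intro r hr <;> simp [hr, hy, h, h']

/-- Negation of all qubits. -/
def flipAll (Q : Type*) : Equiv.Perm (Basis Q) := Equiv.piCongrRight fun _ => flipBit

/-- The tensor product of the Pauli `X` operators of all qubits. -/
def allX (Q : Type*) [Fintype Q] [DecidableEq Q] : Op Q := permMat (flipAll Q)

theorem allX_mul_allX : allX Q * allX Q = 1 := permMat_mul_inv (flipAll Q)

theorem allX_conj_apply (A : Op Q) (x y : Basis Q) :
    (allX Q * A * allX Q) x y = A (flipAll Q x) (flipAll Q y) := by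
  rw [allX, mul_permMat_apply, permMat_mul_apply]
  rfl

theorem Supported.allX_conj {S : Set Q} {A : Op Q} (hA : Supported S A) :
    Supported S (allX Q * A * allX Q) := by
  constructor
  · intro x y h
    rw [allX_conj_apply]
    exact hA.1 _ _ fun h' => h fun r hr => flipBit.injective (h' r hr)
  · intro x y x' y' h h' hx hy
    rw [allX_conj_apply, allX_conj_apply]
    apply hA.2 <;> intro r hr
    · exact congrArg flipBit (h r hr)
    · exact congrArg flipBit (h' r hr)
    · exact congrArg flipBit (hx r hr)
    · exact congrArg flipBit (hy r hr)

/-- Negating every qubit of both indices does not affect their agreement off the support, so only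
the local negation `φ` remains visible. -/
theorem Subsystem.allX_conj_embed (s : Subsystem Q T) {φ : Equiv.Perm T} (hφ : φ⁻¹ = φ)
    (h : ∀ x, s.read (flipAll Q x) = φ (s.read x)) (u : Matrix T T ℂ) :
    allX Q * s.embed u * allX Q = s.embed (permMat φ * u * permMat φ) := by
  funext x y
  rw [allX_conj_apply]
  simp only [embed, h]
  rw [mul_permMat_apply, permMat_mul_apply, hφ]
  have : (∀ r ∉ s.support, flipAll Q x r = flipAll Q y r) ↔ ∀ r ∉ s.support, x r = y r :=
    forall₂_congr fun r _ => flipBit.injective.eq_iff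
  by_cases hxy : ∀ r ∉ s.support, x r = y r
  · rw [if_pos hxy, if_pos (this.2 hxy)]
  · rw [if_neg hxy, if_neg fun h' => hxy (this.1 h')]

end Local

/-! ### Inverses and alternating form of single gates -/

section Gates

variable {Q : Type*} [Fintype Q] [DecidableEq Q]

theorem Gate.supported (g : Gate Q) : Supported g.support g.op := by
  cases g with
  | one q u =>
    rw [Gate.op, applyOne_eq_embed]
    exact (Subsystem.single q).supported_embed _
  | two p q hpq u =>
    rw [Gate.op, applyTwo_eq_embed p q hpq]
    exact (Subsystem.pair p q hpq).supported_embed _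

/-- The inverse gate. -/
def Gate.inv : Gate Q → Gate Q
  | .one q u => .one q (star u)
  | .two p q hpq u => .two p q hpq (star u)

theorem Gate.inv_op (g : Gate Q) : g.inv.op = star g.op := by
  cases g with
  | one q u => simp only [Gate.inv, Gate.op, applyOne_eq_embed, ← Subsystem.embed_star]; rfl
  | two p q hpq u =>
    simp only [Gate.inv, Gate.op, applyTwo_eq_embed p q hpq, ← Subsystem.embed_star]; rfl

theorem Gate.inv_support (g : Gate Q) : g.inv.support = g.support := by cases g <;> rfl

theorem Gate.inv_under {G : SimpleGraph Q} {g : Gate Q} (h : g.Under G) : g.inv.Under G := by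
  cases g <;> exact h

theorem Gate.op_mul_star (g : Gate Q) : g.op * star g.op = 1 := by
  cases g with
  | one q u =>
    simp only [Gate.op, applyOne_eq_embed, ← Subsystem.embed_star, ← Subsystem.embed_mul]
    rw [Unitary.mul_star_self_of_mem u.2, Subsystem.embed_one]
  | two p q hpq u =>
    simp only [Gate.op, applyTwo_eq_embed p q hpq, ← Subsystem.embed_star, ← Subsystem.embed_mul]
    rw [Unitary.mul_star_self_of_mem u.2, Subsystem.embed_one]

/-- A gate is, up to a phase, an alternating product of gates on the same qubits and the global
negation, which collapses to the identity when the negations are omitted. -/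
theorem Gate.exists_interleaved (g : Gate Q) : ∃ (z : Circle) (a : Fin 5 → Gate Q),
    (∀ i, (a i).support = g.support) ∧
    (∀ i, ∀ G : SimpleGraph Q, g.Under G → (a i).Under G) ∧
    g.op = (z : ℂ) • ((a 0).op * (allX Q * (a 1).op * allX Q) * (a 2).op *
      (allX Q * (a 3).op * allX Q) * (a 4).op) ∧
    (a 0).op * (a 1).op * (a 2).op * (a 3).op * (a 4).op = 1 := by
  cases g with
  | one q u =>
    obtain ⟨z, a, hu, ha⟩ := interleaved_one u
    refine ⟨z, fun i => .one q (a i), fun _ => rfl, fun _ _ h => h, ?_, ?_⟩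
    · simp only [Gate.op, applyOne_eq_embed]
      rw [hu]
      simp only [Subsystem.embed_smul, Subsystem.embed_mul]
      simp only [Subsystem.allX_conj_embed (Subsystem.single q) (φ := flipBit) rfl fun _ => rfl,
        Subsystem.embed_mul]
    · simp only [Gate.op, applyOne_eq_embed, ← Subsystem.embed_mul, ha, Subsystem.embed_one]
  | two p q hpq u =>
    obtain ⟨z, a, hu, ha⟩ := interleaved_two u
    refine ⟨z, fun i => .two p q hpq (a i), fun _ => rfl, fun _ _ h => h, ?_, ?_⟩
    · simp only [Gate.op, applyTwo_eq_embed p q hpq]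
      rw [hu]
      simp only [Subsystem.embed_smul, Subsystem.embed_mul]
      simp only [Subsystem.allX_conj_embed (Subsystem.pair p q hpq) (φ := flipTwo) rfl
        fun _ => rfl, Subsystem.embed_mul]
    · simp only [Gate.op, applyTwo_eq_embed p q hpq, ← Subsystem.embed_mul, ha,
        Subsystem.embed_one]

end Gates

/-! ### From gates to layers; implementability in bounded depth -/

section Layers

variable {Q : Type*} [Fintype Q] [DecidableEq Q]

/-- Disjoint supports let `b g` move past `a h` for every later gate `h`, so gatewise factorizations
assemble into layerwise ones. -/
theorem Supported.list_prod_mul {gs : List (Gate Q)}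
    (hgs : gs.Pairwise fun g h => Disjoint g.support h.support) {a b : Gate Q → Op Q}
    (ha : ∀ g, Supported g.support (a g)) (hb : ∀ g, Supported g.support (b g)) :
    (gs.map fun g => a g * b g).prod = (gs.map a).prod * (gs.map b).prod := by
  induction gs with
  | nil => simp
  | cons g gs ih =>
    rw [List.pairwise_cons] at hgs
    simp only [List.map_cons, List.prod_cons, ih hgs.2]
    have hcomm : Commute (b g) (gs.map a).prod := by
      apply Commute.list_prod_right
      intro x hx
      obtain ⟨h, hh, rfl⟩ := List.mem_map.1 hx
      exact (hb g).commute (hgs.1 h hh) (ha h)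
    simp only [mul_assoc]
    rw [← mul_assoc (b g), hcomm.eq, mul_assoc]

theorem list_prod_allX_conj (gs : List (Gate Q)) (a : Gate Q → Op Q) :
    (gs.map fun g => allX Q * a g * allX Q).prod = allX Q * (gs.map a).prod * allX Q := by
  induction gs with
  | nil => simp [allX_mul_allX]
  | cons g gs ih =>
    simp only [List.map_cons, List.prod_cons, ih]
    calc _ = allX Q * a g * (allX Q * allX Q) * (gs.map a).prod * allX Q := by
          simp only [mul_assoc]
      _ = _ := by rw [allX_mul_allX]; simp only [mul_assoc, mul_one]

theorem list_prod_circle_smul (gs : List (Gate Q)) (z : Gate Q → Circle) (a : Gate Q → Op Q) :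
    (gs.map fun g => (z g : ℂ) • a g).prod = ((gs.map z).prod : ℂ) • (gs.map a).prod := by
  induction gs with
  | nil => simp
  | cons g gs ih =>
    simp only [List.map_cons, List.prod_cons, ih, Circle.coe_mul, smul_mul_smul_comm]

/-- The layer obtained by replacing every gate by a gate on the same qubits. -/
def Layer.mapGates (L : Layer Q) (f : Gate Q → Gate Q) (hf : ∀ g, (f g).support = g.support) :
    Layer Q where
  gates := L.gates.map f
  disjoint := by
    rw [List.pairwise_map]
    simpa only [hf] using L.disjoint

theorem Layer.mapGates_op (L : Layer Q) (f : Gate Q → Gate Q)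
    (hf : ∀ g, (f g).support = g.support) :
    (L.mapGates f hf).op = (L.gates.map fun g => (f g).op).prod := by
  simp [Layer.op, Layer.mapGates, Function.comp_def]

/-- The gates of a layer respect the graph `G`. -/
def Layer.Under (G : SimpleGraph Q) (L : Layer Q) : Prop := ∀ g ∈ L.gates, g.Under G

/-- All gates use the same number of factors and the same global negation, so their alternating
forms can be run in parallel; between neighbouring gates the negations cancel in pairs. -/
theorem Layer.exists_interleaved (L : Layer Q) : ∃ (z : Circle) (A : Fin 5 → Layer Q),
    (∀ i, ∀ G : SimpleGraph Q, L.Under G → (A i).Under G) ∧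
    L.op = (z : ℂ) • ((A 0).op * (allX Q * (A 1).op * allX Q) * (A 2).op *
      (allX Q * (A 3).op * allX Q) * (A 4).op) ∧
    (A 0).op * (A 1).op * (A 2).op * (A 3).op * (A 4).op = 1 := by
  choose z a hs hu h h1 using Gate.exists_interleaved (Q := Q)
  have hsup : ∀ i g, Supported g.support (a g i).op := fun i g => hs g i ▸ (a g i).supported
  have hconj : ∀ i g, Supported g.support (allX Q * (a g i).op * allX Q) :=
    fun i g => (hsup i g).allX_conj
  refine ⟨(L.gates.map z).prod, fun i => L.mapGates (fun g => a g i) fun g => hs g i, ?_, ?_, ?_⟩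
  · intro i G hL g hg
    obtain ⟨g', hg', rfl⟩ := List.mem_map.1 hg
    exact hu g' i G (hL g' hg')
  · simp only [Layer.mapGates_op, ← list_prod_allX_conj]
    rw [← Supported.list_prod_mul L.disjoint (hsup 0) (hconj 1),
      ← Supported.list_prod_mul L.disjoint (fun g => (hsup 0 g).mul (hconj 1 g)) (hsup 2),
      ← Supported.list_prod_mul L.disjoint
        (fun g => ((hsup 0 g).mul (hconj 1 g)).mul (hsup 2 g)) (hconj 3),
      ← Supported.list_prod_mul L.disjoint
        (fun g => (((hsup 0 g).mul (hconj 1 g)).mul (hsup 2 g)).mul (hconj 3 g)) (hsup 4),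
      ← list_prod_circle_smul]
    simp only [← h, Layer.op]
  · simp only [Layer.mapGates_op]
    rw [← Supported.list_prod_mul L.disjoint (hsup 0) (hsup 1),
      ← Supported.list_prod_mul L.disjoint (fun g => (hsup 0 g).mul (hsup 1 g)) (hsup 2),
      ← Supported.list_prod_mul L.disjoint
        (fun g => ((hsup 0 g).mul (hsup 1 g)).mul (hsup 2 g)) (hsup 3),
      ← Supported.list_prod_mul L.disjoint
        (fun g => (((hsup 0 g).mul (hsup 1 g)).mul (hsup 2 g)).mul (hsup 3 g)) (hsup 4)]
    simp only [h1, List.map_const', List.prod_replicate, one_pow]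

/-- The operator `A` is implemented by a circuit of depth at most `k` that is constrained to the
graph `G`. -/
def Implements (G : SimpleGraph Q) (k : ℕ) (A : Op Q) : Prop :=
  ∃ W : Circuit Q, W.Under G ∧ W.depth ≤ k ∧ W.op = A

theorem Implements.one (G : SimpleGraph Q) (k : ℕ) : Implements G k (1 : Op Q) :=
  ⟨[], by simp [Circuit.Under], by simp [Circuit.depth], by simp [Circuit.op]⟩

theorem Implements.mono {G : SimpleGraph Q} {k l : ℕ} {A : Op Q} (h : Implements G k A)
    (hkl : k ≤ l) : Implements G l A :=
  let ⟨W, h1, h2, h3⟩ := h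
  ⟨W, h1, h2.trans hkl, h3⟩

theorem Implements.mul {G : SimpleGraph Q} {k l : ℕ} {A B : Op Q} (hA : Implements G k A)
    (hB : Implements G l B) : Implements G (k + l) (A * B) := by
  obtain ⟨W, h1, h2, rfl⟩ := hA
  obtain ⟨V, h3, h4, rfl⟩ := hB
  refine ⟨V ++ W, ?_, ?_, ?_⟩
  · intro L hL
    rcases List.mem_append.1 hL with h | h
    · exact h3 L h
    · exact h1 L h
  · simp only [Circuit.depth, List.length_append] at *
    omega
  · simp [Circuit.op]

theorem Implements.layer {G : SimpleGraph Q} {L : Layer Q} (hL : L.Under G) :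
    Implements G 1 L.op :=
  ⟨[L], fun L' hL' => by rwa [List.mem_singleton.1 hL'], by simp [Circuit.depth], by simp [Circuit.op]⟩

/-- A single gate as a layer. -/
def Gate.layer (g : Gate Q) : Layer Q := ⟨[g], by simp⟩

theorem Implements.gate {G : SimpleGraph Q} {g : Gate Q} (hg : g.Under G) :
    Implements G 1 g.op := by
  have : g.layer.op = g.op := by simp [Layer.op, Gate.layer]
  rw [← this]
  exact Implements.layer fun g' hg' => by rwa [List.mem_singleton.1 hg']

theorem Layer.op_mul_star (L : Layer Q) : L.op * star L.op = 1 := by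
  rw [Layer.op]
  induction L.gates with
  | nil => simp
  | cons g gs ih =>
    simp only [List.map_cons, List.prod_cons, star_mul]
    rw [mul_assoc, ← mul_assoc _ _ (star g.op), ih, one_mul, g.op_mul_star]

theorem Layer.star_op (L : Layer Q) : star L.op = (L.mapGates Gate.inv Gate.inv_support).op := by
  have h : L.op * (L.mapGates Gate.inv Gate.inv_support).op = 1 := by
    rw [Layer.mapGates_op, Layer.op, ← Supported.list_prod_mul L.disjoint Gate.supported
      fun g => g.inv_support ▸ g.inv.supported]
    simp [Gate.inv_op, Gate.op_mul_star]
  have h' : star L.op * L.op = 1 := mul_eq_one_comm.1 L.op_mul_star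
  calc star L.op = star L.op * (L.op * (L.mapGates Gate.inv Gate.inv_support).op) := by
        rw [h, mul_one]
    _ = _ := by rw [← mul_assoc, h', one_mul]

theorem Circuit.op_nil : Circuit.op ([] : Circuit Q) = 1 := by simp [Circuit.op]

theorem Circuit.op_cons (L : Layer Q) (C : Circuit Q) :
    Circuit.op (L :: C) = Circuit.op C * L.op := by simp [Circuit.op]

theorem Circuit.op_mul_star (C : Circuit Q) : C.op * star C.op = 1 := by
  induction C with
  | nil => simp [Circuit.op_nil]
  | cons L C ih =>
    rw [Circuit.op_cons, star_mul, mul_assoc, ← mul_assoc _ _ (star (Circuit.op C)),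
      L.op_mul_star, one_mul, ih]

theorem Implements.star {G : SimpleGraph Q} {k : ℕ} {A : Op Q} (h : Implements G k A) :
    Implements G k (star A) := by
  obtain ⟨W, h1, h2, rfl⟩ := h
  refine Implements.mono ?_ h2
  clear h2
  induction W with
  | nil => rw [Circuit.op_nil, star_one]; exact Implements.one G _
  | cons L C ih =>
    rw [Circuit.op_cons, star_mul, L.star_op]
    have hL : (L.mapGates Gate.inv Gate.inv_support).Under G := by
      intro g hg
      obtain ⟨g', hg', rfl⟩ := List.mem_map.1 hg
      exact Gate.inv_under (h1 L (by simp) g' hg')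
    refine ((Implements.layer hL).mul (ih fun L' hL' => h1 L' (by simp [hL']))).mono ?_
    simp only [Circuit.depth, List.length_cons]
    omega

theorem Implements.mul_star {G : SimpleGraph Q} {k : ℕ} {A : Op Q} (h : Implements G k A) :
    A * Star.star A = 1 := by
  obtain ⟨W, -, -, rfl⟩ := h
  exact W.op_mul_star

end Layers

/-! ### Calculus of controlled operators -/

section Control

variable {Q : Type*} [Fintype Q] [DecidableEq Q]

/-- The operator that applies `A` or `B` to `Q` according to whether the control qubit is `|0⟩`
or `|1⟩`. -/
def block (A B : Op Q) : Op (Option Q) := fun x y =>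
  if x none = y none then
    (if x none = true then B else A) (fun q => x (some q)) (fun q => y (some q))
  else 0

theorem block_mul (A B A' B' : Op Q) : block A B * block A' B' = block (A * A') (B * B') := by
  funext x y
  rw [Matrix.mul_apply,
    ← (Equiv.piOptionEquivProd (α := Q) (β := fun _ => Bool)).symm.sum_comp,
    Fintype.sum_prod_type, Fintype.sum_bool]
  simp only [block, Equiv.piOptionEquivProd]
  cases hx : x none <;> cases hy : y none <;> simp [Matrix.mul_apply]

theorem controlled_eq_block (U : Op Q) : controlled U = block 1 U := by
  funext x y
  simp only [controlled, block]
  split_ifs <;> simp_all [Matrix.one_apply]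

theorem block_one_one : block (1 : Op Q) 1 = 1 := by
  funext x y
  simp only [block, ite_self]
  by_cases h : x = y
  · simp [h, Matrix.one_apply]
  · rw [Matrix.one_apply_ne h]
    split_ifs with h1
    · rw [Matrix.one_apply_ne]
      intro h2
      apply h
      funext r
      cases r with
      | none => exact h1
      | some r => exact congrFun h2 r
    · rfl

/-- The operator `A` on `Q`, tensored with the identity on the control qubit. -/
def liftOp : Op Q →* Op (Option Q) where
  toFun A := block A A
  map_one' := block_one_one
  map_mul' A B := (block_mul A A B B).symm

/-- A gate on `Q` as a gate on `Q` and the control qubit. -/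
def Gate.lift : Gate Q → Gate (Option Q)
  | .one q u => .one (some q) u
  | .two p q hpq u => .two (some p) (some q) (by simpa using hpq) u

theorem Gate.lift_support (g : Gate Q) : g.lift.support = some '' g.support := by
  cases g <;> simp [Gate.lift, Gate.support, Set.image_pair]

theorem Gate.lift_under {G : SimpleGraph Q} {v : Q} {g : Gate Q} (h : g.Under G) :
    g.lift.Under (withControl G v) := by
  cases g with
  | one q u => trivial
  | two p q hpq u =>
    exact Or.inl (SimpleGraph.map_adj_apply' h (by simpa using hpq))

theorem Gate.lift_op (g : Gate Q) : g.lift.op = liftOp g.op := by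
  funext x y
  cases g with
  | one q u =>
    simp only [Gate.lift, Gate.op, applyOne, liftOp, MonoidHom.coe_mk, OneHom.coe_mk, block,
      ite_self, Option.forall]
    split_ifs <;> simp_all
  | two p q hpq u =>
    simp only [Gate.lift, Gate.op, applyTwo, liftOp, MonoidHom.coe_mk, OneHom.coe_mk, block,
      ite_self, Option.forall]
    split_ifs <;> simp_all

/-- A layer on `Q` as a layer on `Q` and the control qubit. -/
def Layer.lift (L : Layer Q) : Layer (Option Q) where
  gates := L.gates.map Gate.lift
  disjoint := by
    rw [List.pairwise_map]
    refine L.disjoint.imp fun h => ?_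
    rw [Gate.lift_support, Gate.lift_support]
    exact (Set.disjoint_image_iff (Option.some_injective Q)).2 h

theorem Implements.lift {G : SimpleGraph Q} {k : ℕ} {A : Op Q} (h : Implements G k A) (v : Q) :
    Implements (withControl G v) k (liftOp A) := by
  obtain ⟨W, h1, h2, rfl⟩ := h
  refine ⟨W.map Layer.lift, ?_, by simpa [Circuit.depth] using h2, ?_⟩
  · intro L hL g hg
    obtain ⟨L', hL', rfl⟩ := List.mem_map.1 hL
    obtain ⟨g', hg', rfl⟩ := List.mem_map.1 hg
    exact Gate.lift_under (h1 L' hL' g' hg')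
  · have : ∀ L : Layer Q, L.lift.op = liftOp L.op := fun L => by
      simp only [Layer.op, Layer.lift, map_list_prod, List.map_map]
      congr 2
      funext g
      exact g.lift_op
    simp only [Circuit.op, map_list_prod, List.map_map, List.map_reverse, Function.comp_def, this]

theorem controlled_mul (A B : Op Q) : controlled (A * B) = controlled A * controlled B := by
  simp only [controlled_eq_block, block_mul, one_mul]

theorem controlled_conj {A B : Op Q} (U : Op Q) (h : A * B = 1) :
    controlled (A * U * B) = liftOp A * controlled U * liftOp B := by
  simp only [controlled_eq_block, liftOp, MonoidHom.coe_mk, OneHom.coe_mk, block_mul, mul_one, h]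

/-- On the `|0⟩` branch each `controlled X` is trivial and the product collapses by `h`; on the
`|1⟩` branch the whole product acts. The factors `A`, …, `E` need no control. -/
theorem controlled_interleaved (z : ℂ) (X A B C D E : Op Q) (h : A * B * C * D * E = 1) :
    controlled (z • (A * (X * B * X) * C * (X * D * X) * E)) =
      controlled (z • 1) * (liftOp A * (controlled X * liftOp B * controlled X) * liftOp C *
        (controlled X * liftOp D * controlled X) * liftOp E) := by
  simp only [controlled_eq_block, liftOp, MonoidHom.coe_mk, OneHom.coe_mk, block_mul, mul_one,
    one_mul, h, smul_mul_assoc]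

end Control

/-! ### Spreading a negation over the lattice by CNOTs -/

section Fanout

variable {Q : Type*} [Fintype Q] [DecidableEq Q]

/-- The controlled negation on two bits. -/
def cnotPerm : Equiv.Perm (Bool × Bool) :=
  Function.Involutive.toPerm (fun t => (t.1, xor t.1 t.2)) (by rintro ⟨_ | _, _ | _⟩ <;> rfl)

theorem cnotPerm_apply (t : Bool × Bool) : cnotPerm t = (t.1, xor t.1 t.2) := rfl

/-- Negation of the qubits in `S`. -/
def flipOn (S : Finset Q) : Equiv.Perm (Basis Q) :=
  Function.Involutive.toPerm (fun x q => xor (decide (q ∈ S)) (x q)) fun x => by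
    funext q; simp

theorem flipOn_apply (S : Finset Q) (x : Basis Q) (q : Q) :
    flipOn S x q = xor (decide (q ∈ S)) (x q) := rfl

/-- The controlled negation of the qubit `q` with control `p`, on basis states. -/
def cnotBasis {p q : Q} (hpq : p ≠ q) : Equiv.Perm (Basis Q) :=
  Function.Involutive.toPerm (fun x => Function.update x q (xor (x p) (x q))) fun x => by
    funext r
    by_cases hr : r = q
    · subst hr; simp [hpq]
    · simp [hr]

theorem cnotBasis_apply {p q : Q} (hpq : p ≠ q) (x : Basis Q) (r : Q) :
    cnotBasis hpq x r = if r = q then xor (x p) (x q) else x r := by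
  change Function.update x q (xor (x p) (x q)) r = _
  rw [Function.update_apply]

/-- Conjugation by a CNOT copies an X on its control to its target. -/
theorem cnotBasis_conj_flipOn {p q : Q} (hpq : p ≠ q) {S : Finset Q} (hp : p ∈ S) (hq : q ∉ S) :
    cnotBasis hpq * flipOn S * (cnotBasis hpq)⁻¹ = flipOn (insert q S) := by
  rw [mul_inv_eq_iff_eq_mul]
  ext x r
  simp only [Equiv.Perm.mul_apply, cnotBasis_apply, flipOn_apply, Finset.mem_insert]
  by_cases hr : r = q
  · subst hr
    simp [hp, hq]
  · simp [hr]

/-- The CNOT gate. -/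
def Gate.cnot {p q : Q} (hpq : p ≠ q) : Gate Q := .two p q hpq (permUnitary cnotPerm)

theorem Gate.cnot_op {p q : Q} (hpq : p ≠ q) : (Gate.cnot hpq).op = permMat (cnotBasis hpq) := by
  rw [Gate.cnot, Gate.op, applyTwo_eq_embed p q hpq]
  refine Subsystem.embed_permMat _ _ _ fun y => ?_
  funext r
  simp only [cnotBasis_apply, Subsystem.pair, cnotPerm_apply, Function.update_apply]
  split_ifs <;> simp_all

theorem controlled_permMat_flipOn (v : Q) :
    controlled (permMat (flipOn {v})) =
      (Gate.cnot (p := none) (q := some v) (by simp) : Gate (Option Q)).op := by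
  rw [Gate.cnot_op]
  funext x y
  simp only [controlled, permMat]
  have h : x = cnotBasis (p := none) (q := some v) (by simp) y ↔ x none = y none ∧
      ∀ r, x (some r) = if r = v then xor (y none) (y (some v)) else y (some r) := by
    rw [funext_iff, Option.forall]
    simp [cnotBasis_apply]
  have h1 : ((fun q => x (some q)) = flipOn {v} fun q => y (some q)) ↔
      ∀ r, x (some r) = if r = v then !(y (some v)) else y (some r) := by
    rw [funext_iff]
    refine forall_congr' fun r => ?_
    rw [flipOn_apply]
    by_cases hr : r = v <;> simp [hr]
  have h2 : ((fun q => x (some q)) = fun q => y (some q)) ↔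
      ∀ r, x (some r) = if r = v then y (some v) else y (some r) := by
    rw [funext_iff]
    refine forall_congr' fun r => ?_
    by_cases hr : r = v <;> simp [hr]
  simp only [h, h1, h2]
  cases hx : x none <;> cases hy : y none <;> simp

/-- Phase kickback: a controlled global phase is diag(1, z) on the control qubit, so no gate on `Q`
is needed. -/
theorem controlled_smul_one (z : Circle) :
    controlled ((z : ℂ) • (1 : Op Q)) =
      (Gate.one none (diagUnitary fun b => if b then z else 1) : Gate (Option Q)).op := by
  funext x y
  simp only [controlled, Gate.op, applyOne, diagUnitary, Option.forall]
  have h : ((fun q => x (some q)) = fun q => y (some q)) ↔ ∀ q, x (some q) = y (some q) :=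
    funext_iff
  cases hx : x none <;> cases hy : y none <;> simp [Matrix.one_apply, h]

/-- A circuit of depth at most `k` that conjugates the negation of `S` to the negation of `S'`. -/
def Spreads (G : SimpleGraph Q) (k : ℕ) (S S' : Finset Q) : Prop :=
  ∃ B : Op Q, Implements G k B ∧ B * permMat (flipOn S) * star B = permMat (flipOn S')

theorem Spreads.refl (G : SimpleGraph Q) (k : ℕ) (S : Finset Q) : Spreads G k S S :=
  ⟨1, Implements.one G k, by simp⟩

theorem Spreads.trans {G : SimpleGraph Q} {k l : ℕ} {S S' S'' : Finset Q} (h : Spreads G k S S')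
    (h' : Spreads G l S' S'') : Spreads G (l + k) S S'' := by
  obtain ⟨B, hB, hS⟩ := h
  obtain ⟨B', hB', hS'⟩ := h'
  refine ⟨B' * B, hB'.mul hB, ?_⟩
  rw [← hS', ← hS, star_mul]
  simp only [mul_assoc]

/-- By `h1` each new site has a neighbour in `S` to control its CNOT; by `h2` no site controls two
of them, so all these CNOTs fit into one layer. -/
theorem Spreads.step {G : SimpleGraph Q} {S S' : Finset Q} (hSS : S ⊆ S')
    (h1 : ∀ q ∈ S', q ∉ S → ∃ p ∈ S, G.Adj p q)
    (h2 : ∀ p ∈ S, ∀ q ∈ S', ∀ q' ∈ S', q ∉ S → q' ∉ S → G.Adj p q → G.Adj p q' → q = q') :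
    Spreads G 1 S S' := by
  -- The new sites are added one at a time. Recording that each gate joins `S` to `T` gives the
  -- disjointness from the next CNOT.
  have key : ∀ T : Finset Q, Disjoint T S → T ⊆ S' → ∃ L : Layer Q, L.Under G ∧
      (∀ g ∈ L.gates, ∃ p ∈ S, ∃ q ∈ T, G.Adj p q ∧ g.support = {p, q}) ∧
      L.op * permMat (flipOn S) * star L.op = permMat (flipOn (T ∪ S)) := by
    intro T
    induction T using Finset.induction_on with
    | empty =>
      intro _ _
      exact ⟨⟨[], by simp⟩, by simp [Layer.Under], by simp, by simp [Layer.op]⟩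
    | insert q T hq ih =>
      intro hd hT
      rw [Finset.disjoint_insert_left] at hd
      obtain ⟨L, hL, hLs, hop⟩ := ih hd.2 ((Finset.subset_insert _ _).trans hT)
      obtain ⟨p, hp, hpq⟩ := h1 q (hT (by simp)) hd.1
      have hdis : (Gate.cnot hpq.ne :: L.gates).Pairwise
          fun g h => Disjoint g.support h.support := by
        refine List.pairwise_cons.2 ⟨fun g hg => ?_, L.disjoint⟩
        obtain ⟨p', hp', q', hq', hadj, hs⟩ := hLs g hg
        have hq'S : q' ∉ S := Finset.disjoint_left.1 hd.2 hq'
        rw [hs, Set.disjoint_left]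
        rintro r (rfl | hr) (hr' | hr')
        · subst hr'
          exact hq (h2 r hp q (hT (by simp)) q' (hT (by simp [hq'])) hd.1 hq'S hpq hadj ▸ hq')
        · rw [Set.mem_singleton_iff] at hr'
          exact hq'S (hr' ▸ hp)
        · rw [Set.mem_singleton_iff] at hr
          exact hd.1 (hr ▸ hr' ▸ hp')
        · rw [Set.mem_singleton_iff] at hr hr'
          exact hq (hr ▸ hr' ▸ hq')
      refine ⟨⟨Gate.cnot hpq.ne :: L.gates, hdis⟩, ?_, ?_, ?_⟩
      · intro g hg
        rcases List.mem_cons.1 hg with rfl | hg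
        · exact hpq
        · exact hL g hg
      · intro g hg
        rcases List.mem_cons.1 hg with rfl | hg
        · exact ⟨p, hp, q, by simp, hpq, rfl⟩
        · obtain ⟨p', hp', q', hq', h⟩ := hLs g hg
          exact ⟨p', hp', q', by simp [hq'], h⟩
      · have e : Layer.op ⟨Gate.cnot hpq.ne :: L.gates, hdis⟩ =
            (Gate.cnot hpq.ne).op * L.op := by simp [Layer.op]
        rw [e, star_mul]
        calc _ = (Gate.cnot hpq.ne).op * (L.op * permMat (flipOn S) * star L.op) *
              star (Gate.cnot hpq.ne).op := by simp only [mul_assoc]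
          _ = _ := by
            rw [hop, Gate.cnot_op, star_permMat, ← permMat_mul, ← permMat_mul,
              cnotBasis_conj_flipOn _ (by simp [hp]) (by simp [hq, hd.1]), Finset.insert_union]
  obtain ⟨L, hL, -, hop⟩ := key (S' \ S) Finset.sdiff_disjoint Finset.sdiff_subset
  rw [Finset.sdiff_union_of_subset hSS] at hop
  exact ⟨L.op, Implements.layer hL, hop⟩

theorem Spreads.iterate {G : SimpleGraph Q} {S : ℕ → Finset Q}
    (h : ∀ t, Spreads G 1 (S t) (S (t + 1))) (k : ℕ) : Spreads G k (S 0) (S k) := by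
  induction k with
  | zero => exact Spreads.refl G 0 _
  | succ k ih => exact (ih.trans (h k)).imp fun B hB => ⟨hB.1.mono (by omega), hB.2⟩

theorem lattice_adj {l₁ l₂ : ℕ} {x y : Fin l₁ × Fin l₂} : (lattice l₁ l₂).Adj x y ↔
    ((x.1.val + 1 = y.1.val ∨ y.1.val + 1 = x.1.val) ∧ x.2.val = y.2.val) ∨
    ((x.2.val + 1 = y.2.val ∨ y.2.val + 1 = x.2.val) ∧ x.1.val = y.1.val) := by
  simp only [lattice, SimpleGraph.boxProd_adj, SimpleGraph.pathGraph_adj, Fin.ext_iff]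

/-- The negation grows along the line through `v` in one direction, then in the other, and then the
full line sweeps across the lattice both ways. Growing in one direction at a time lets each boundary
site serve only one new site; the four phases take l₁, l₁, l₂ and l₂ layers. -/
theorem lattice_spreads {l₁ l₂ : ℕ} (v : Fin l₁ × Fin l₂) :
    Spreads (lattice l₁ l₂) (2 * (l₁ + l₂)) {v} Finset.univ := by
  obtain ⟨a, b⟩ := v
  have p1 := Spreads.iterate (G := lattice l₁ l₂) (S := fun t => Finset.univ.filter fun q =>
    q.2.val = b.val ∧ a.val ≤ q.1.val ∧ q.1.val ≤ a.val + t) (fun t => by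
      refine Spreads.step ?_ ?_ ?_
      · intro q
        simp only [Finset.mem_filter, Finset.mem_univ, true_and]
        omega
      · rintro ⟨i, j⟩
        simp only [Finset.mem_filter, Finset.mem_univ, true_and]
        intro h h'
        refine ⟨(⟨i - 1, by omega⟩, j), ?_, lattice_adj.2 ?_⟩
        · dsimp only
          omega
        · simp only [and_true]
          omega
      · rintro ⟨i, j⟩ h ⟨i', j'⟩ h' ⟨i'', j''⟩ h''
        simp only [Finset.mem_filter, Finset.mem_univ, true_and, lattice_adj, Prod.mk.injEq,
          Fin.ext_iff] at *
        omega) l₁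
  have p2 := Spreads.iterate (G := lattice l₁ l₂) (S := fun t => Finset.univ.filter fun q =>
    q.2.val = b.val ∧ a.val ≤ q.1.val + t) (fun t => by
      refine Spreads.step ?_ ?_ ?_
      · intro q
        simp only [Finset.mem_filter, Finset.mem_univ, true_and]
        omega
      · rintro ⟨i, j⟩
        simp only [Finset.mem_filter, Finset.mem_univ, true_and]
        intro h h'
        refine ⟨(⟨i + 1, by omega⟩, j), ?_, lattice_adj.2 ?_⟩
        · dsimp only
          omega
        · simp
      · rintro ⟨i, j⟩ h ⟨i', j'⟩ h' ⟨i'', j''⟩ h''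
        simp only [Finset.mem_filter, Finset.mem_univ, true_and, lattice_adj, Prod.mk.injEq,
          Fin.ext_iff] at *
        omega) l₁
  have p3 := Spreads.iterate (G := lattice l₁ l₂) (S := fun t => Finset.univ.filter fun q =>
    b.val ≤ q.2.val ∧ q.2.val ≤ b.val + t) (fun t => by
      refine Spreads.step ?_ ?_ ?_
      · intro q
        simp only [Finset.mem_filter, Finset.mem_univ, true_and]
        omega
      · rintro ⟨i, j⟩
        simp only [Finset.mem_filter, Finset.mem_univ, true_and]
        intro h h'
        refine ⟨(i, ⟨j - 1, by omega⟩), ?_, lattice_adj.2 ?_⟩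
        · dsimp only
          omega
        · simp only [and_true]
          omega
      · rintro ⟨i, j⟩ h ⟨i', j'⟩ h' ⟨i'', j''⟩ h''
        simp only [Finset.mem_filter, Finset.mem_univ, true_and, lattice_adj, Prod.mk.injEq,
          Fin.ext_iff] at *
        omega) l₂
  have p4 := Spreads.iterate (G := lattice l₁ l₂) (S := fun t => Finset.univ.filter fun q =>
    b.val ≤ q.2.val + t) (fun t => by
      refine Spreads.step ?_ ?_ ?_
      · intro q
        simp only [Finset.mem_filter, Finset.mem_univ, true_and]
        omega
      · rintro ⟨i, j⟩
        simp only [Finset.mem_filter, Finset.mem_univ, true_and]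
        intro h h'
        refine ⟨(i, ⟨j + 1, by omega⟩), ?_, lattice_adj.2 ?_⟩
        · dsimp only
          omega
        · simp
      · rintro ⟨i, j⟩ h ⟨i', j'⟩ h' ⟨i'', j''⟩ h''
        simp only [Finset.mem_filter, Finset.mem_univ, true_and, lattice_adj, Prod.mk.injEq,
          Fin.ext_iff] at *
        omega) l₂
  have e0 : (Finset.univ.filter fun q : Fin l₁ × Fin l₂ =>
      q.2.val = b.val ∧ a.val ≤ q.1.val ∧ q.1.val ≤ a.val + 0) = {(a, b)} := by
    ext ⟨i, j⟩
    simp only [Finset.mem_filter, Finset.mem_univ, true_and, Finset.mem_singleton, Prod.mk.injEq,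
      Fin.ext_iff]
    omega
  have e1 : (Finset.univ.filter fun q : Fin l₁ × Fin l₂ =>
      q.2.val = b.val ∧ a.val ≤ q.1.val ∧ q.1.val ≤ a.val + l₁) =
      Finset.univ.filter fun q => q.2.val = b.val ∧ a.val ≤ q.1.val + 0 := by
    ext ⟨i, j⟩
    simp only [Finset.mem_filter, Finset.mem_univ, true_and]
    omega
  have e2 : (Finset.univ.filter fun q : Fin l₁ × Fin l₂ => q.2.val = b.val ∧ a.val ≤ q.1.val + l₁) =
      Finset.univ.filter fun q => b.val ≤ q.2.val ∧ q.2.val ≤ b.val + 0 := by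
    ext ⟨i, j⟩
    simp only [Finset.mem_filter, Finset.mem_univ, true_and]
    omega
  have e3 : (Finset.univ.filter fun q : Fin l₁ × Fin l₂ => b.val ≤ q.2.val ∧ q.2.val ≤ b.val + l₂) =
      Finset.univ.filter fun q => b.val ≤ q.2.val + 0 := by
    ext ⟨i, j⟩
    simp only [Finset.mem_filter, Finset.mem_univ, true_and]
    omega
  have e4 : (Finset.univ.filter fun q : Fin l₁ × Fin l₂ => b.val ≤ q.2.val + l₂) =
      Finset.univ := by
    ext ⟨i, j⟩
    simp only [Finset.mem_filter, Finset.mem_univ, true_and, iff_true]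
    omega
  rw [e0, e1] at p1
  rw [e2] at p2
  rw [e3] at p3
  rw [e4] at p4
  exact (((p1.trans p2).trans p3).trans p4).imp fun B hB => ⟨hB.1.mono (by omega), hB.2⟩

theorem implements_controlled_allX {G : SimpleGraph Q} {v : Q} {k : ℕ}
    (h : Spreads G k {v} Finset.univ) :
    Implements (withControl G v) (2 * k + 1) (controlled (allX Q)) := by
  obtain ⟨B, hB, hop⟩ := h
  have e : flipAll Q = flipOn Finset.univ := by
    ext x q
    simp [flipOn_apply, flipAll, flipBit]
  rw [allX, e, ← hop, controlled_conj _ hB.mul_star, controlled_permMat_flipOn]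
  refine (((hB.lift v).mul (Implements.gate ?_)).mul (hB.star.lift v)).mono (by omega)
  exact Or.inr (by simp [SimpleGraph.edge_adj])

/-- The depth counts four controlled negations, five uncontrolled layers and the phase gate on the
control qubit. -/
theorem implements_controlled_layer {G : SimpleGraph Q} {v : Q} {k : ℕ}
    (h : Implements (withControl G v) k (controlled (allX Q))) {L : Layer Q} (hL : L.Under G) :
    Implements (withControl G v) (4 * k + 6) (controlled L.op) := by
  obtain ⟨z, A, hA, hop, h1⟩ := L.exists_interleaved
  have hi : ∀ i, Implements (withControl G v) 1 (liftOp (A i).op) :=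
    fun i => (Implements.layer (hA i G hL)).lift v
  rw [hop, controlled_interleaved _ _ _ _ _ _ _ h1, controlled_smul_one]
  exact (Implements.mul (Implements.gate (g := Gate.one _ _) trivial) (((((hi 0).mul ((h.mul (hi 1)).mul h)).mul
    (hi 2)).mul ((h.mul (hi 3)).mul h)).mul (hi 4))).mono (by omega)

end Fanout

/-! ### Permuting lattice sites by parallel swaps of neighbours -/

section Routing

variable {Q : Type*}

/-- The composition `f (k - 1) ∘ ⋯ ∘ f 1 ∘ f 0`. -/
def iterProd {M : Type*} [Monoid M] (f : ℕ → M) : ℕ → M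
  | 0 => 1
  | k + 1 => f k * iterProd f k

theorem commute_iterProd {M : Type*} [Monoid M] {f : ℕ → M} {a : M} {k : ℕ}
    (h : ∀ t < k, Commute a (f t)) : Commute a (iterProd f k) := by
  induction k with
  | zero => exact Commute.one_right a
  | succ k ih => exact (h k (by omega)).mul_right (ih fun t ht => h t (by omega))

/-- Each `g s` only has to pass the `f t` of strictly earlier times. -/
theorem iterProd_mul {M : Type*} [Monoid M] {f g : ℕ → M}
    (h : ∀ s t, t < s → Commute (g s) (f t)) (k : ℕ) :
    iterProd (fun t => f t * g t) k = iterProd f k * iterProd g k := by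
  induction k with
  | zero => simp [iterProd]
  | succ k ih =>
    have hc : Commute (g k) (iterProd f k) := commute_iterProd fun t ht => h k t ht
    simp only [iterProd, ih, mul_assoc]
    rw [← mul_assoc (g k), hc.eq, mul_assoc]

theorem iterProd_delay {M : Type*} [Monoid M] (f : ℕ → M) (k : ℕ) :
    iterProd (fun t => if t < 2 then 1 else f (t - 2)) (k + 2) = iterProd f k := by
  induction k with
  | zero => simp [iterProd]
  | succ k ih =>
    rw [show k + 1 + 2 = (k + 2) + 1 from rfl, iterProd, ih]
    simp [iterProd]

theorem map_iterProd {M N : Type*} [Monoid M] [Monoid N] (φ : M →* N) (f : ℕ → M) (k : ℕ) :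
    φ (iterProd f k) = iterProd (fun t => φ (f t)) k := by
  induction k with
  | zero => simp [iterProd]
  | succ k ih => simp [iterProd, ih]

/-- An involution that exchanges disjoint pairs of adjacent vertices. -/
def IsSwapStep (G : SimpleGraph Q) (τ : Equiv.Perm Q) : Prop :=
  ∀ q, τ (τ q) = q ∧ (τ q = q ∨ G.Adj q (τ q))

theorem IsSwapStep.one (G : SimpleGraph Q) : IsSwapStep G 1 := fun q => by simp

theorem IsSwapStep.swap [DecidableEq Q] {G : SimpleGraph Q} {p q : Q} (h : G.Adj p q) :
    IsSwapStep G (Equiv.swap p q) := by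
  refine fun r => ⟨Equiv.swap_apply_self p q r, ?_⟩
  by_cases hp : r = p
  · subst hp; simp [h]
  · by_cases hq : r = q
    · subst hq; simp [h.symm]
    · exact Or.inl (Equiv.swap_apply_of_ne_of_ne hp hq)

theorem IsSwapStep.mul {G : SimpleGraph Q} {σ τ : Equiv.Perm Q} (hσ : IsSwapStep G σ)
    (hτ : IsSwapStep G τ) (h : σ.Disjoint τ) : IsSwapStep G (σ * τ) := by
  have hc : σ * τ = τ * σ := h.commute
  intro q
  constructor
  · calc (σ * τ) ((σ * τ) q) = (σ * τ) ((τ * σ) q) := by rw [hc]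
      _ = q := by simp [(hτ _).1, (hσ _).1]
  · rcases h q with h | h
    · rw [hc, Equiv.Perm.mul_apply, h]
      exact (hτ q).2
    · rw [Equiv.Perm.mul_apply, h]
      exact (hσ q).2

/-- Pipelined insertion: the item destined for the last place `m` is carried there by neighbour
swaps, and the remaining permutation of the first `m` places starts two steps later, trailing behind
the carry. The bound `q.val ≤ t + 1` on the moved places keeps the two processes disjoint, so each
extra place costs only two steps. -/
theorem path_swapSteps {n : ℕ} (m : ℕ) (hm : m ≤ n) (σ : Equiv.Perm (Fin n))
    (hσ : ∀ q : Fin n, m ≤ q.val → σ q = q) :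
    ∃ f : ℕ → Equiv.Perm (Fin n), (∀ t, IsSwapStep (SimpleGraph.pathGraph n) (f t)) ∧
      (∀ t q, f t q ≠ q → q.val ≤ t + 1) ∧ iterProd f (2 * m) = σ := by
  induction m generalizing σ with
  | zero =>
    refine ⟨fun _ => 1, fun _ => IsSwapStep.one _, by simp, ?_⟩
    ext q
    simp [iterProd, hσ q]
  | succ m ih =>
    set e : Fin n := ⟨m, hm⟩ with he
    set p : Fin n := σ⁻¹ e with hp
    have hσp : σ p = e := by simp [hp]
    have hpm : p.val ≤ m := by
      by_contra h
      have h1 := hσ p (by omega)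
      rw [hσp] at h1
      rw [← h1] at h
      simp [he] at h
    -- The item at `p` waits until time `p`, so that a swap at time `t` always involves the places
    -- `t` and `t + 1`.
    let s : ℕ → Equiv.Perm (Fin n) := fun t =>
      if h : p.val ≤ t ∧ t < m then Equiv.swap ⟨t, by omega⟩ ⟨t + 1, by omega⟩ else 1
    have hs_fix : ∀ t (q : Fin n), q.val ≠ t → q.val ≠ t + 1 → s t q = q := by
      intro t q h1 h2
      simp only [s]
      split_ifs with h
      · exact Equiv.swap_apply_of_ne_of_ne (fun h => h1 (by rw [h])) fun h => h2 (by rw [h])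
      · rfl
    have hs_high : ∀ t (q : Fin n), m < q.val → s t q = q := by
      intro t q h1
      by_cases h : p.val ≤ t ∧ t < m
      · exact hs_fix t q (by omega) (by omega)
      · simp [s, h]
    have hs_step : ∀ t, IsSwapStep (SimpleGraph.pathGraph n) (s t) := by
      intro t
      simp only [s]
      split_ifs with h
      · exact IsSwapStep.swap (SimpleGraph.pathGraph_adj.2 (Or.inl rfl))
      · exact IsSwapStep.one _
    have hs_p : ∀ N, (iterProd s N p).val = max p.val (min N m) := by
      intro N
      induction N with
      | zero => simp [iterProd]
      | succ N ihN =>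
        rw [iterProd, Equiv.Perm.mul_apply]
        by_cases h : p.val ≤ N ∧ N < m
        · have : iterProd s N p = ⟨N, by omega⟩ := Fin.ext (by rw [ihN]; simp only []; omega)
          rw [this]
          simp only [s, dif_pos h, Equiv.swap_apply_left]
          omega
        · simp only [s, dif_neg h, Equiv.Perm.one_apply, ihN]
          omega
    have hs_fixes : ∀ N (q : Fin n), m < q.val → iterProd s N q = q := by
      intro N q hq
      induction N with
      | zero => simp [iterProd]
      | succ N ihN => rw [iterProd, Equiv.Perm.mul_apply, ihN, hs_high N q hq]
    set c := iterProd s (2 * m + 2) with hc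
    have hcp : c p = e := Fin.ext (by rw [hs_p]; simp only [he]; omega)
    obtain ⟨f, hf, hfm, hfσ⟩ := ih (by omega) (σ * c⁻¹) (by
      intro q hq
      rw [Equiv.Perm.mul_apply]
      by_cases h : q = e
      · rw [h, Equiv.Perm.inv_eq_iff_eq.2 hcp.symm, hσp]
      · have hq' : m < q.val := lt_of_le_of_ne hq fun h' => h (Fin.ext h'.symm)
        rw [Equiv.Perm.inv_eq_iff_eq.2 (hs_fixes _ q hq').symm, hσ q hq'])
    -- After a delay of two, the moved places at time `t` are at most `t - 1`: disjoint from the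
    -- carry at that time and at every later one.
    let g : ℕ → Equiv.Perm (Fin n) := fun t => if t < 2 then 1 else f (t - 2)
    have hg : ∀ t q, g t q ≠ q → q.val < t := by
      intro t q h
      simp only [g] at h
      split_ifs at h with ht
      · exact absurd rfl h
      · have := hfm _ _ h
        omega
    have hdis : ∀ a b, b ≤ a → (g b).Disjoint (s a) := by
      intro a b hab q
      by_cases h : g b q = q
      · exact Or.inl h
      · have := hg b q h
        exact Or.inr (hs_fix a q (by omega) (by omega))
    refine ⟨fun t => g t * s t, fun t => IsSwapStep.mul ?_ (hs_step t) (hdis t t le_rfl), ?_, ?_⟩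
    · simp only [g]
      split_ifs
      · exact IsSwapStep.one _
      · exact hf _
    · intro t q h
      by_contra hq
      apply h
      rw [Equiv.Perm.mul_apply, hs_fix t q (by omega) (by omega)]
      by_contra h'
      have := hg t q h'
      omega
    · rw [iterProd_mul (fun a b hab => (hdis a b hab.le).commute.symm),
        show 2 * (m + 1) = 2 * m + 2 by ring, iterProd_delay, hfσ, ← hc, inv_mul_cancel_right]

/-- The permutation of the lattice that permutes the sites in each column. -/
def columnPerm (m n : ℕ) : (Fin n → Equiv.Perm (Fin m)) →* Equiv.Perm (Fin m × Fin n) where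
  toFun σ :=
    { toFun := fun x => (σ x.2 x.1, x.2)
      invFun := fun x => ((σ x.2)⁻¹ x.1, x.2)
      left_inv := fun x => by simp
      right_inv := fun x => by simp }
  map_one' := rfl
  map_mul' _ _ := rfl

/-- The permutation of the lattice that permutes the sites in each row. -/
def rowPerm (m n : ℕ) : (Fin m → Equiv.Perm (Fin n)) →* Equiv.Perm (Fin m × Fin n) where
  toFun σ :=
    { toFun := fun x => (x.1, σ x.1 x.2)
      invFun := fun x => (x.1, (σ x.1)⁻¹ x.2)
      left_inv := fun x => by simp
      right_inv := fun x => by simp }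
  map_one' := rfl
  map_mul' _ _ := rfl

theorem iterProd_apply {ι M : Type*} [Monoid M] (f : ℕ → ι → M) (k : ℕ) (i : ι) :
    iterProd f k i = iterProd (fun t => f t i) k := map_iterProd (Pi.evalMonoidHom _ i) f k

/-- All columns are routed simultaneously, each by `path_swapSteps`, so the number of steps does not
depend on `n`. -/
theorem columnPerm_swapSteps {m n : ℕ} (σ : Equiv.Perm (Fin m × Fin n))
    (hσ : ∀ x, (σ x).2 = x.2) : ∃ f : ℕ → Equiv.Perm (Fin m × Fin n),
      (∀ t, IsSwapStep (lattice m n) (f t)) ∧ iterProd f (2 * m) = σ := by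
  have hinj : ∀ j, Function.Injective fun i => (σ (i, j)).1 := fun j i i' h =>
    congrArg Prod.fst (σ.injective (Prod.ext h (by rw [hσ, hσ])))
  have h : ∀ j, ∃ f : ℕ → Equiv.Perm (Fin m), _ := fun j => path_swapSteps m le_rfl
    (Equiv.ofBijective _ (Finite.injective_iff_bijective.1 (hinj j))) fun q hq => by omega
  choose f hf _ hfσ using h
  refine ⟨fun t => columnPerm m n fun j => f j t, fun t => ?_, ?_⟩
  · rintro ⟨i, j⟩
    refine ⟨congrArg (·, j) (hf j t i).1, (hf j t i).2.imp (congrArg (·, j)) fun h => ?_⟩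
    exact lattice_adj.2 (Or.inl ⟨SimpleGraph.pathGraph_adj.1 h, rfl⟩)
  · rw [← map_iterProd]
    apply Equiv.ext
    rintro ⟨i, j⟩
    change (iterProd (fun t j => f j t) (2 * m) j i, j) = _
    rw [iterProd_apply, hfσ j]
    exact Prod.ext rfl (hσ (i, j)).symm

theorem rowPerm_swapSteps {m n : ℕ} (σ : Equiv.Perm (Fin m × Fin n))
    (hσ : ∀ x, (σ x).1 = x.1) : ∃ f : ℕ → Equiv.Perm (Fin m × Fin n),
      (∀ t, IsSwapStep (lattice m n) (f t)) ∧ iterProd f (2 * n) = σ := by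
  have hinj : ∀ i, Function.Injective fun j => (σ (i, j)).2 := fun i j j' h =>
    congrArg Prod.snd (σ.injective (Prod.ext (by rw [hσ, hσ]) h))
  have h : ∀ i, ∃ f : ℕ → Equiv.Perm (Fin n), _ := fun i => path_swapSteps n le_rfl
    (Equiv.ofBijective _ (Finite.injective_iff_bijective.1 (hinj i))) fun q hq => by omega
  choose f hf _ hfσ using h
  refine ⟨fun t => rowPerm m n fun i => f i t, fun t => ?_, ?_⟩
  · rintro ⟨i, j⟩
    refine ⟨congrArg (i, ·) (hf i t j).1, (hf i t j).2.imp (congrArg (i, ·)) fun h => ?_⟩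
    exact lattice_adj.2 (Or.inr ⟨SimpleGraph.pathGraph_adj.1 h, rfl⟩)
  · rw [← map_iterProd]
    apply Equiv.ext
    rintro ⟨i, j⟩
    change (i, iterProd (fun t i => f i t) (2 * n) i j) = _
    rw [iterProd_apply, hfσ i]
    exact Prod.ext (hσ (i, j)).symm rfl

theorem card_filter_mem_of_card_fiber {ι J : Type*} [DecidableEq J] {k : ℕ} {X : Finset ι}
    {s : ι → J} (hs : ∀ j, (X.filter fun x => s x = j).card = k) (A : Finset J) :
    (X.filter fun x => s x ∈ A).card = A.card * k := by
  have h : ∀ x ∈ X.filter fun x => s x ∈ A, s x ∈ A := fun x hx => (Finset.mem_filter.1 hx).2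
  rw [Finset.card_eq_sum_card_fiberwise (s := X.filter fun x => s x ∈ A) (f := s) (t := A)
    fun x hx => h x hx, Finset.sum_const_nat]
  intro j hj
  rw [← hs j, Finset.filter_filter]
  congr 1
  ext x
  simp only [Finset.mem_filter]
  constructor
  · exact fun h => ⟨h.1, h.2.2⟩
  · exact fun h => ⟨h.1, h.2 ▸ hj, h.2⟩

/-- A regular bipartite multigraph of degree `k` (with edge set `X` and end vertex maps `s`, `t`)
has a proper edge colouring with `k` colours. -/
theorem exists_edge_colouring {ι J : Type*} [DecidableEq ι] [Fintype J] [DecidableEq J] (k : ℕ)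
    (X : Finset ι) (s t : ι → J) (hs : ∀ j, (X.filter fun x => s x = j).card = k)
    (ht : ∀ j, (X.filter fun x => t x = j).card = k) :
    ∃ c : ι → ℕ, (∀ x ∈ X, c x < k) ∧
      ∀ x ∈ X, ∀ y ∈ X, c x = c y → (s x = s y ∨ t x = t y) → x = y := by
  induction k generalizing X with
  | zero =>
    have hX : ∀ x, x ∉ X := by
      intro x hx
      have := Finset.card_eq_zero.1 (hs (s x))
      exact Finset.notMem_empty x (this ▸ Finset.mem_filter.2 ⟨hx, rfl⟩)
    exact ⟨fun _ => 0, fun x hx => absurd hx (hX x), fun x hx => absurd hx (hX x)⟩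
  | succ k ih =>
    -- Hall's condition holds by regularity: the (k + 1)|A| edges leaving `A` are among the (k +
    -- 1)|T| edges entering `T`. The resulting perfect matching receives the colour `k`, and its
    -- removal leaves a `k`-regular multigraph.
    have hall := (Finset.all_card_le_biUnion_card_iff_exists_injective
      fun j => (X.filter fun x => s x = j).image t).1 (by
        intro A
        set T := A.biUnion fun j => (X.filter fun x => s x = j).image t with hT
        have h1 := card_filter_mem_of_card_fiber hs A
        have h2 := card_filter_mem_of_card_fiber ht T
        have h3 : (X.filter fun x => s x ∈ A) ⊆ X.filter fun x => t x ∈ T := by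
          intro x hx
          rw [Finset.mem_filter] at hx ⊢
          refine ⟨hx.1, Finset.mem_biUnion.2 ⟨s x, hx.2, Finset.mem_image.2 ⟨x, ?_, rfl⟩⟩⟩
          exact Finset.mem_filter.2 ⟨hx.1, rfl⟩
        have h4 := Finset.card_le_card h3
        rw [h1, h2] at h4
        exact Nat.le_of_mul_le_mul_right h4 (Nat.succ_pos k))
    obtain ⟨f, hf, hft⟩ := hall
    have hx : ∀ j, ∃ x ∈ X, s x = j ∧ t x = f j := fun j => by
      obtain ⟨x, hx, hxt⟩ := Finset.mem_image.1 (hft j)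
      exact ⟨x, (Finset.mem_filter.1 hx).1, (Finset.mem_filter.1 hx).2, hxt⟩
    choose x hxX hxs hxt using hx
    have hfb : Function.Bijective f := Finite.injective_iff_bijective.1 hf
    have hs' : ∀ j, ((X \ Finset.univ.image x).filter fun y => s y = j).card = k := by
      intro j
      have : (X \ Finset.univ.image x).filter (fun y => s y = j) =
          (X.filter fun y => s y = j).erase (x j) := by
        ext y
        simp only [Finset.mem_filter, Finset.mem_sdiff, Finset.mem_image, Finset.mem_univ,
          true_and, not_exists, Finset.mem_erase]
        constructor
        · rintro ⟨⟨h1, h2⟩, h3⟩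
          exact ⟨fun h => h2 j h.symm, h1, h3⟩
        · rintro ⟨h1, h2, h3⟩
          refine ⟨⟨h2, fun i hi => h1 ?_⟩, h3⟩
          rw [← hi, hxs i] at h3
          rw [← hi, h3]
      rw [this, Finset.card_erase_of_mem (Finset.mem_filter.2 ⟨hxX j, hxs j⟩), hs j]
      rfl
    have ht' : ∀ j, ((X \ Finset.univ.image x).filter fun y => t y = j).card = k := by
      intro j
      obtain ⟨i, rfl⟩ := hfb.2 j
      have : (X \ Finset.univ.image x).filter (fun y => t y = f i) =
          (X.filter fun y => t y = f i).erase (x i) := by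
        ext y
        simp only [Finset.mem_filter, Finset.mem_sdiff, Finset.mem_image, Finset.mem_univ,
          true_and, not_exists, Finset.mem_erase]
        constructor
        · rintro ⟨⟨h1, h2⟩, h3⟩
          exact ⟨fun h => h2 i h.symm, h1, h3⟩
        · rintro ⟨h1, h2, h3⟩
          refine ⟨⟨h2, fun i' hi => h1 ?_⟩, h3⟩
          rw [← hi, hxt i'] at h3
          rw [← hi, hf h3]
      rw [this, Finset.card_erase_of_mem (Finset.mem_filter.2 ⟨hxX i, hxt i⟩), ht (f i)]
      rfl
    obtain ⟨c, hc, hcc⟩ := ih _ hs' ht'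
    have hmem : ∀ y ∈ X, (¬ ∃ i, x i = y) → y ∈ X \ Finset.univ.image x := fun y hy h => by
      simpa [hy] using h
    classical
    refine ⟨fun y => if ∃ i, x i = y then k else c y, ?_, ?_⟩
    · intro y hy
      dsimp only
      split_ifs with h
      · exact Nat.lt_succ_self k
      · exact (hc y (hmem y hy h)).trans (Nat.lt_succ_self k)
    · intro y hy y' hy' hyy hst
      dsimp only at hyy
      split_ifs at hyy with h h' h'
      · obtain ⟨i, rfl⟩ := h
        obtain ⟨i', rfl⟩ := h'
        rw [hxs, hxs, hxt, hxt, hf.eq_iff, or_self] at hst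
        rw [hst]
      · have := hc y' (hmem y' hy' h')
        omega
      · have := hc y (hmem y hy h)
        omega
      · exact hcc y (hmem y hy h) y' (hmem y' hy' h') hyy hst

/-- Every permutation of a rectangular array is a permutation within columns, followed by one
within rows and another one within columns. -/
theorem exists_column_row_column {m n : ℕ} (σ : Equiv.Perm (Fin m × Fin n)) :
    ∃ α β γ : Equiv.Perm (Fin m × Fin n), (∀ x, (α x).2 = x.2) ∧ (∀ x, (β x).1 = x.1) ∧
      (∀ x, (γ x).2 = x.2) ∧ σ = γ * β * α := by
  have hcard : ∀ j : Fin n, (Finset.univ.filter fun x : Fin m × Fin n => x.2 = j).card = m := by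
    intro j
    have : (Finset.univ.filter fun x : Fin m × Fin n => x.2 = j) =
        Finset.univ.image fun i : Fin m => (i, j) := by
      ext ⟨i, j'⟩
      simp [eq_comm]
    rw [this, Finset.card_image_of_injective _ fun i i' h => congrArg Prod.fst h]
    simp
  -- Each site is an edge from its column to its target column, and its colour is the row through
  -- which it travels. Equally coloured sites differ in both columns, so both intermediate positions
  -- (colour, old column) and (colour, new column) are injective in the site.
  obtain ⟨c, hc, hcc⟩ := exists_edge_colouring m Finset.univ (fun x : Fin m × Fin n => x.2)
    (fun x => (σ x).2) hcard (by
      intro j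
      refine Eq.trans ?_ (hcard j)
      exact Finset.card_bij (fun x _ => σ x) (by simp) (by simp) fun y hy =>
        ⟨σ⁻¹ y, by simpa using hy, by simp⟩)
  let α : Equiv.Perm (Fin m × Fin n) := Equiv.ofBijective (fun x => (⟨c x, hc x (by simp)⟩, x.2))
    (Finite.injective_iff_bijective.1 fun x y h => by
      rw [Prod.mk.injEq, Fin.mk.injEq] at h
      exact hcc x (by simp) y (by simp) h.1 (Or.inl h.2))
  let β : Equiv.Perm (Fin m × Fin n) :=
    Equiv.ofBijective (fun x => (⟨c x, hc x (by simp)⟩, (σ x).2))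
    (Finite.injective_iff_bijective.1 fun x y h => by
      rw [Prod.mk.injEq, Fin.mk.injEq] at h
      exact hcc x (by simp) y (by simp) h.1 (Or.inr h.2))
  refine ⟨α, β * α⁻¹, σ * β⁻¹, fun x => rfl, fun x => ?_, fun x => ?_, by group⟩
  · obtain ⟨y, rfl⟩ := α.surjective x
    rw [Equiv.Perm.mul_apply, Equiv.Perm.inv_def, Equiv.symm_apply_apply]
    rfl
  · obtain ⟨y, rfl⟩ := β.surjective x
    rw [Equiv.Perm.mul_apply, Equiv.Perm.inv_def, Equiv.symm_apply_apply]
    rfl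

end Routing

/-! ### SWAP circuits, and making the pairs of a layer adjacent -/

section PermOp

variable {Q : Type*} [Fintype Q] [DecidableEq Q]

/-- The permutation of the basis states induced by a permutation of the qubits. -/
def basisPerm (Q : Type*) : Equiv.Perm Q →* Equiv.Perm (Basis Q) where
  toFun σ := Equiv.arrowCongr σ (Equiv.refl Bool)
  map_one' := rfl
  map_mul' _ _ := rfl

/-- The operator that moves the qubit `q` to `σ q`. -/
def permOp (σ : Equiv.Perm Q) : Op Q := permMat (basisPerm Q σ)

theorem permOp_one : permOp (1 : Equiv.Perm Q) = 1 := by rw [permOp, map_one, permMat_one]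

theorem permOp_mul (σ τ : Equiv.Perm Q) : permOp (σ * τ) = permOp σ * permOp τ := by
  rw [permOp, map_mul, permMat_mul]; rfl

theorem permOp_mul_inv (σ : Equiv.Perm Q) : permOp σ * permOp σ⁻¹ = 1 := by
  rw [← permOp_mul, mul_inv_cancel, permOp_one]

theorem permOp_inv_mul (σ : Equiv.Perm Q) : permOp σ⁻¹ * permOp σ = 1 := by
  rw [← permOp_mul, inv_mul_cancel, permOp_one]

theorem permOp_conj_apply (σ : Equiv.Perm Q) (A : Op Q) (x y : Basis Q) :
    (permOp σ * A * permOp σ⁻¹) x y = A (x ∘ σ) (y ∘ σ) := by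
  rw [permOp, permOp, mul_permMat_apply, permMat_mul_apply]
  rfl

/-- The gate with its qubits moved by `σ`. -/
def Gate.perm (σ : Equiv.Perm Q) : Gate Q → Gate Q
  | .one q u => .one (σ q) u
  | .two p q hpq u => .two (σ p) (σ q) (by simpa using hpq) u

theorem Gate.perm_support (σ : Equiv.Perm Q) (g : Gate Q) :
    (g.perm σ).support = σ '' g.support := by
  cases g <;> simp [Gate.perm, Gate.support, Set.image_pair]

theorem Gate.perm_op (σ : Equiv.Perm Q) (g : Gate Q) :
    (g.perm σ).op = permOp σ * g.op * permOp σ⁻¹ := by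
  funext x y
  rw [permOp_conj_apply]
  cases g with
  | one q u =>
    simp only [Gate.perm, Gate.op, applyOne]
    congr 1
    rw [eq_iff_iff, ← σ.forall_congr_right]
    simp
  | two p q hpq u =>
    simp only [Gate.perm, Gate.op, applyTwo]
    congr 1
    rw [eq_iff_iff, ← σ.forall_congr_right]
    simp

/-- The layer with its qubits moved by `σ`. -/
def Layer.perm (σ : Equiv.Perm Q) (L : Layer Q) : Layer Q where
  gates := L.gates.map (Gate.perm σ)
  disjoint := by
    rw [List.pairwise_map]
    refine L.disjoint.imp fun h => ?_
    rw [Gate.perm_support, Gate.perm_support]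
    exact (Set.disjoint_image_iff σ.injective).2 h

theorem Layer.perm_op (σ : Equiv.Perm Q) (L : Layer Q) :
    (L.perm σ).op = permOp σ * L.op * permOp σ⁻¹ := by
  simp only [Layer.op, Layer.perm, List.map_map]
  induction L.gates with
  | nil => simp [permOp_mul_inv]
  | cons g gs ih =>
    simp only [List.map_cons, List.prod_cons, ih, Function.comp_apply, Gate.perm_op]
    calc _ = permOp σ * g.op * (permOp σ⁻¹ * permOp σ) * (gs.map Gate.op).prod * permOp σ⁻¹ := by
          simp only [mul_assoc]
      _ = _ := by rw [permOp_inv_mul]; simp only [mul_assoc, mul_one]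

/-- The SWAP gate. -/
def Gate.swap {p q : Q} (hpq : p ≠ q) : Gate Q :=
  .two p q hpq (permUnitary (Equiv.prodComm Bool Bool))

theorem Gate.swap_op {p q : Q} (hpq : p ≠ q) : (Gate.swap hpq).op = permOp (Equiv.swap p q) := by
  rw [Gate.swap, Gate.op, applyTwo_eq_embed p q hpq]
  refine Subsystem.embed_permMat _ _ _ fun y => ?_
  funext r
  change y ((Equiv.swap p q).symm r) = Function.update (Function.update y p (y q)) q (y p) r
  rw [Equiv.symm_swap, Function.update_apply, Function.update_apply, Equiv.swap_apply_def]
  split_ifs <;> simp_all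

/-- The exchanged pairs are split off one by one. That gates touch only moved qubits is carried
along, because the pair just split off is fixed by the remaining involution. -/
theorem IsSwapStep.exists_layer {G : SimpleGraph Q} (τ : Equiv.Perm Q) (hτ : IsSwapStep G τ) :
    ∃ L : Layer Q, L.Under G ∧ L.op = permOp τ ∧ ∀ g ∈ L.gates, ∀ q ∈ g.support, τ q ≠ q := by
  induction h : τ.support.card using Nat.strong_induction_on generalizing τ with
  | _ k ih =>
    by_cases hone : τ = 1
    · subst hone
      exact ⟨⟨[], by simp⟩, by simp [Layer.Under], by simp [Layer.op, permOp_one], by simp⟩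
    obtain ⟨p, hp⟩ : ∃ p, τ p ≠ p := by
      by_contra! h
      exact hone (Equiv.ext h)
    have hadj : G.Adj p (τ p) := (hτ p).2.resolve_left hp
    set τ' := Equiv.swap p (τ p) * τ with hτ'
    have hp' : τ' p = p := by simp [hτ']
    have hq' : τ' (τ p) = τ p := by simp [hτ', (hτ p).1]
    have hr' : ∀ r, r ≠ p → r ≠ τ p → τ' r = τ r := fun r h1 h2 => by
      rw [hτ', Equiv.Perm.mul_apply]
      refine Equiv.swap_apply_of_ne_of_ne (fun h => h2 ?_) fun h => h1 (τ.injective h)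
      rw [← h, (hτ r).1]
    have hmoved : ∀ r, τ' r ≠ r → r ≠ p ∧ r ≠ τ p ∧ τ r ≠ r := by
      intro r hr
      have h1 : r ≠ p := fun h => hr (h ▸ hp')
      have h2 : r ≠ τ p := fun h => hr (h ▸ hq')
      exact ⟨h1, h2, hr' r h1 h2 ▸ hr⟩
    have hstep : IsSwapStep G τ' := by
      intro r
      by_cases h1 : r = p
      · subst h1; simp [hp']
      by_cases h2 : r = τ p
      · subst h2; simp [hq']
      rw [hr' r h1 h2, hr' (τ r) (fun h => h2 (by rw [← h, (hτ r).1]))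
        fun h => h1 (τ.injective h)]
      exact hτ r
    have hcard : τ'.support.card < k := by
      rw [← h]
      apply Finset.card_lt_card
      rw [Finset.ssubset_iff_of_subset fun r hr => by
        rw [Equiv.Perm.mem_support] at hr ⊢
        exact (hmoved r hr).2.2]
      exact ⟨p, by simpa using hp, by simpa using hp'⟩
    obtain ⟨L, hL, hop, hs⟩ := ih _ hcard τ' hstep rfl
    refine ⟨⟨Gate.swap hadj.ne :: L.gates, ?_⟩, ?_, ?_, ?_⟩
    · refine List.pairwise_cons.2 ⟨fun g hg => ?_, L.disjoint⟩
      rw [Set.disjoint_right]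
      intro r hr hr2
      have := hmoved r (hs g hg r hr)
      rcases hr2 with rfl | hr2
      · exact this.1 rfl
      · exact this.2.1 hr2
    · intro g hg
      rcases List.mem_cons.1 hg with rfl | hg
      · exact hadj
      · exact hL g hg
    · have : τ = Equiv.swap p (τ p) * τ' := by rw [hτ', ← mul_assoc, Equiv.swap_mul_self, one_mul]
      conv_rhs => rw [this]
      rw [permOp_mul, ← hop, ← Gate.swap_op hadj.ne]
      simp [Layer.op]
    · intro g hg r hr
      rcases List.mem_cons.1 hg with rfl | hg
      · rcases hr with rfl | hr
        · exact hp
        · rw [Set.mem_singleton_iff] at hr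
          rw [hr, (hτ p).1]
          exact hp.symm
      · exact (hmoved r (hs g hg r hr)).2.2

theorem implements_permOp_iterProd {G : SimpleGraph Q} {f : ℕ → Equiv.Perm Q}
    (hf : ∀ t, IsSwapStep G (f t)) (k : ℕ) : Implements G k (permOp (iterProd f k)) := by
  induction k with
  | zero => rw [iterProd, permOp_one]; exact Implements.one G 0
  | succ k ih =>
    obtain ⟨L, hL, hop, -⟩ := (hf k).exists_layer
    rw [iterProd, permOp_mul, ← hop]
    exact ((Implements.layer hL).mul ih).mono (by omega)

theorem implements_permOp {l₁ l₂ : ℕ} (σ : Equiv.Perm (Fin l₁ × Fin l₂)) :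
    Implements (lattice l₁ l₂) (4 * (l₁ + l₂)) (permOp σ) := by
  obtain ⟨α, β, γ, hα, hβ, hγ, rfl⟩ := exists_column_row_column σ
  obtain ⟨f, hf, rfl⟩ := columnPerm_swapSteps α hα
  obtain ⟨g, hg, rfl⟩ := rowPerm_swapSteps β hβ
  obtain ⟨h, hh, rfl⟩ := columnPerm_swapSteps γ hγ
  rw [permOp_mul, permOp_mul]
  exact (((implements_permOp_iterProd hh _).mul (implements_permOp_iterProd hg _)).mul
    (implements_permOp_iterProd hf _)).mono (by omega)

/-- The sites of the lattice in boustrophedon order. -/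
def snake (m n : ℕ) : Fin (m * n) ≃ Fin m × Fin n :=
  finProdFinEquiv.symm.trans <| rowPerm m n fun i =>
    if i.val % 2 = 0 then 1 else Fin.revPerm

theorem snake_fst {m n : ℕ} (k : Fin (m * n)) : (snake m n k).1.val = k.val / n := rfl

theorem snake_snd {m n : ℕ} (k : Fin (m * n)) : (snake m n k).2.val =
    if k.val / n % 2 = 0 then k.val % n else n - (k.val % n + 1) := by
  change ((if k.val / n % 2 = 0 then (1 : Equiv.Perm (Fin n)) else Fin.revPerm) k.modNat).val = _
  split_ifs
  · rfl
  · exact Fin.val_rev _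

theorem snake_adj {m n : ℕ} {k : ℕ} (hk : k + 1 < m * n) :
    (lattice m n).Adj (snake m n ⟨k, by omega⟩) (snake m n ⟨k + 1, hk⟩) := by
  have hn : 0 < n := Nat.pos_of_ne_zero fun h => by simp [h] at hk
  rw [lattice_adj]
  simp only [snake_fst, snake_snd]
  have hdm := Nat.div_add_mod k n
  have hlt := Nat.mod_lt k hn
  -- Either the next site lies in the same row, or the row ends and the reversed direction of the
  -- next row keeps the column unchanged.
  by_cases hc : k % n + 1 < n
  · have hk1 : k + 1 = (k % n + 1) + n * (k / n) := by omega
    have h1 : (k + 1) / n = k / n := by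
      rw [hk1, Nat.add_mul_div_left _ _ hn, Nat.div_eq_of_lt hc, zero_add]
    have h2 : (k + 1) % n = k % n + 1 := by
      rw [hk1, Nat.add_mul_mod_self_left, Nat.mod_eq_of_lt hc]
    rw [h1, h2]
    right
    refine ⟨?_, rfl⟩
    split_ifs <;> omega
  · have h0 : k % n + 1 = n := by omega
    have hk1 : k + 1 = n * (k / n + 1) := by rw [mul_add, mul_one]; omega
    have h1 : (k + 1) / n = k / n + 1 := by rw [hk1, Nat.mul_div_cancel_left _ hn]
    have h2 : (k + 1) % n = 0 := by rw [hk1, Nat.mul_mod_right]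
    rw [h1, h2]
    left
    refine ⟨Or.inl rfl, ?_⟩
    split_ifs <;> omega

/-- The pairs of qubits of disjoint gates can be put on consecutive places of a line. -/
theorem exists_consecutive {n : ℕ} (e₀ : Q ≃ Fin n) (gs : List (Gate Q))
    (hgs : gs.Pairwise fun g h => Disjoint g.support h.support) :
    ∃ (m : ℕ) (e : Q ≃ Fin n),
      (∀ q, (e q).val < m → ∃ g ∈ gs, q ∈ g.support) ∧
      ∀ g ∈ gs, ∀ p q hpq u, g = .two p q hpq u → (e q).val < m ∧ (e q).val = (e p).val + 1 := by
  induction gs with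
  | nil => exact ⟨0, e₀, by simp, by simp⟩
  | cons g gs ih =>
    rw [List.pairwise_cons] at hgs
    obtain ⟨m, e, h1, h2⟩ := ih hgs.2
    cases g with
    | one q u =>
      refine ⟨m, e, fun q hq => ?_, fun g hg p q hpq u h => ?_⟩
      · obtain ⟨g, hg, hgq⟩ := h1 q hq
        exact ⟨g, by simp [hg], hgq⟩
      · rcases List.mem_cons.1 hg with rfl | hg
        · cases h
        · exact h2 g hg p q hpq u h
    | two p q hpq u =>
      -- The places below `m` are held by qubits of other gates. Hence `p` and `q` can be brought to
      -- `m` and `m + 1` by two transpositions that leave those places alone.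
      have hnot : ∀ r ∈ ({p, q} : Set Q), m ≤ (e r).val := by
        intro r hr
        by_contra h
        obtain ⟨g, hg, hgr⟩ := h1 r (by omega)
        exact Set.disjoint_left.1 (hgs.1 g hg) hr hgr
      have hp := hnot p (by simp)
      have hq := hnot q (by simp)
      have hne : (e p).val ≠ (e q).val := fun h => hpq (e.injective (Fin.ext h))
      have hn : m + 1 < n := by
        have := (e p).isLt
        have := (e q).isLt
        omega
      set a : Fin n := ⟨m, by omega⟩ with ha
      set b : Fin n := ⟨m + 1, hn⟩ with hb
      have hab : a ≠ b := by simp [ha, hb]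
      set e₁ := e.trans (Equiv.swap (e p) a) with he₁
      have he₁p : e₁ p = a := by simp [he₁]
      have hlow : ∀ (c d : Fin n), m ≤ c.val → m ≤ d.val → ∀ x : Fin n, x.val < m →
          Equiv.swap c d x = x := fun c d hc hd x hx =>
        Equiv.swap_apply_of_ne_of_ne (fun h => by subst h; omega) fun h => by subst h; omega
      have he₁q : m ≤ (e₁ q).val := by
        by_contra h
        have h' := hlow (e p) a hp le_rfl (e₁ q) (by omega)
        rw [he₁, Equiv.trans_apply, Equiv.swap_apply_self] at h'
        rw [he₁, Equiv.trans_apply, ← h'] at h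
        exact h hq
      set e₂ := e₁.trans (Equiv.swap (e₁ q) b) with he₂
      have he₂q : e₂ q = b := by simp [he₂]
      have he₂p : e₂ p = a := by
        rw [he₂, Equiv.trans_apply, he₁p]
        exact Equiv.swap_apply_of_ne_of_ne
          (fun h => hpq (e₁.injective (he₁p.trans h))) hab
      have hsame : ∀ r, (e r).val < m → e₂ r = e r := by
        intro r hr
        have h3 : e₁ r = e r := by
          rw [he₁, Equiv.trans_apply, hlow (e p) a hp le_rfl _ hr]
        rw [he₂, Equiv.trans_apply, h3, hlow (e₁ q) b he₁q (by simp [hb]) _ hr]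
      have hback : ∀ r, (e₂ r).val < m → (e r).val < m := by
        intro r hr
        have h3 : e₂ (e.symm (e₂ r)) = e₂ r := by
          rw [hsame _ (by simpa using hr)]
          simp
        have h4 := e₂.injective h3
        rw [← h4]
        simpa using hr
      refine ⟨m + 2, e₂, fun r hr => ?_, fun g hg p' q' hpq' u' h => ?_⟩
      · by_cases hr1 : (e₂ r).val < m
        · obtain ⟨g, hg, hgr⟩ := h1 r (hback r hr1)
          exact ⟨g, by simp [hg], hgr⟩
        · refine ⟨_, List.mem_cons_self, ?_⟩
          by_cases hr2 : (e₂ r).val = m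
          · have : r = p := e₂.injective (by rw [he₂p]; exact Fin.ext hr2)
            exact Or.inl this
          · have : r = q := e₂.injective (by
              rw [he₂q]
              refine Fin.ext ?_
              simp only [hb]
              omega)
            exact Or.inr this
      · rcases List.mem_cons.1 hg with rfl | hg
        · cases h
          rw [he₂p, he₂q]
          simp [ha, hb]
        · obtain ⟨h3, h4⟩ := h2 g hg p' q' hpq' u' h
          rw [hsame q' h3, hsame p' (by omega)]
          exact ⟨by omega, h4⟩

theorem Layer.exists_perm_under_lattice {l₁ l₂ : ℕ} (L : Layer (Fin l₁ × Fin l₂)) :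
    ∃ σ : Equiv.Perm (Fin l₁ × Fin l₂), (L.perm σ).Under (lattice l₁ l₂) := by
  obtain ⟨m, e, -, h⟩ := exists_consecutive (snake l₁ l₂).symm L.gates L.disjoint
  refine ⟨e.trans (snake l₁ l₂), fun g hg => ?_⟩
  obtain ⟨g, hg', rfl⟩ := List.mem_map.1 hg
  cases g with
  | one q u => trivial
  | two p q hpq u =>
    obtain ⟨-, h'⟩ := h _ hg' p q hpq u rfl
    have hlt : (e p).val + 1 < l₁ * l₂ := h' ▸ (e q).isLt
    have := snake_adj hlt
    have e1 : (⟨(e p).val + 1, hlt⟩ : Fin (l₁ * l₂)) = e q := Fin.ext h'.symm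
    rw [e1] at this
    exact this

end PermOp

/-! ### Depth of the controlled circuit -/

section Main

/-- Write L = l₁ + l₂. The controlled negation costs 4L + 1, hence a controlled local layer 16L +
10, and routing there and back 8L. The sum 24L + 10 is at most 34L. -/
theorem implements_controlled_circuit {l₁ l₂ : ℕ} (v : Fin l₁ × Fin l₂)
    (C : Circuit (Fin l₁ × Fin l₂)) :
    Implements (withControl (lattice l₁ l₂) v) (C.depth * (34 * (l₁ + l₂)))
      (controlled C.op) := by
  have hpos : 0 < l₁ := v.1.pos
  have hlayer : ∀ L : Layer (Fin l₁ × Fin l₂),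
      Implements (withControl (lattice l₁ l₂) v) (34 * (l₁ + l₂)) (controlled L.op) := by
    intro L
    obtain ⟨σ, hσ⟩ := L.exists_perm_under_lattice
    have hop : L.op = permOp σ⁻¹ * (L.perm σ).op * permOp σ := by
      rw [Layer.perm_op]
      calc L.op = (permOp σ⁻¹ * permOp σ) * L.op * (permOp σ⁻¹ * permOp σ) := by
            rw [permOp_inv_mul, one_mul, mul_one]
        _ = _ := by simp only [mul_assoc]
    rw [hop, controlled_conj _ (permOp_inv_mul σ)]
    have hX := implements_controlled_allX (lattice_spreads v)
    refine ((((implements_permOp σ⁻¹).lift v).mul (implements_controlled_layer hX hσ)).mul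
      ((implements_permOp σ).lift v)).mono ?_
    have : 0 < l₂ := v.2.pos
    omega
  induction C with
  | nil =>
    rw [Circuit.op_nil, controlled_eq_block, block_one_one]
    exact Implements.one _ _
  | cons L C ih =>
    rw [Circuit.op_cons, controlled_mul]
    refine (ih.mul (hlayer L)).mono (le_of_eq ?_)
    simp only [Circuit.depth, List.length_cons]
    ring

end Main

/-! ### Implementation and outcome probability of the Hadamard test -/

section HadamardTest

variable {Q : Type*} [Fintype Q] [DecidableEq Q]

theorem gateH_mem : gateH ∈ Matrix.unitaryGroup Bool ℂ := by
  have h2 : ((√2 : ℝ) : ℂ)⁻¹ * ((√2 : ℝ) : ℂ)⁻¹ = 1 / 2 := by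
    rw [← mul_inv, ← Complex.ofReal_mul, Real.mul_self_sqrt (by norm_num)]
    norm_num
  rw [Matrix.mem_unitaryGroup_iff]
  ext a b
  rw [Matrix.mul_apply, Fintype.sum_bool]
  cases a <;> cases b <;>
    simp [gateH, Matrix.star_apply, -mul_inv_rev, Complex.conj_ofReal] <;>
    linear_combination (2 : ℂ) * h2

theorem gateS_mem : gateS ∈ Matrix.unitaryGroup Bool ℂ := by
  rw [Matrix.mem_unitaryGroup_iff, gateS, Matrix.star_eq_conjTranspose,
    Matrix.diagonal_conjTranspose, Matrix.diagonal_mul_diagonal, ← Matrix.diagonal_one]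
  congr 1
  funext a
  cases a <;> simp

theorem Implements.hadamardTest {G : SimpleGraph (Option Q)} {k : ℕ} {U : Op Q}
    (h : Implements G k (controlled U)) (j : ℕ) : Implements G (k + 3) (hadamardTest U j) := by
  have hH : Implements G 1 (applyOne none gateH) :=
    Implements.gate (g := .one none ⟨gateH, gateH_mem⟩) trivial
  have hS : Implements G 1 (applyOne none (gateS ^ j)) :=
    Implements.gate (g := .one none ⟨gateS ^ j, pow_mem gateS_mem j⟩) trivial
  exact (((hH.mul hS).mul h).mul hH).mono (by omega)

/-- The basis state with control bit `b` and remaining bits `w`. -/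
def withBit (b : Bool) (w : Basis Q) : Basis (Option Q) :=
  Equiv.piOptionEquivProd.symm (b, w)

theorem withBit_none (b : Bool) (w : Basis Q) : withBit b w none = b := rfl

theorem withBit_some (b : Bool) (w : Basis Q) (q : Q) : withBit b w (some q) = w q := rfl

theorem sum_withBit {M : Type*} [AddCommMonoid M] (f : Basis (Option Q) → M) :
    ∑ x, f x = ∑ b : Bool, ∑ w : Basis Q, f (withBit b w) := by
  rw [← (Equiv.piOptionEquivProd (α := Q) (β := fun _ => Bool)).symm.sum_comp,
    Fintype.sum_prod_type]
  rfl

theorem applyOne_none_withBit (u : Matrix Bool Bool ℂ) (b c : Bool) (w w' : Basis Q) :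
    applyOne none u (withBit b w) (withBit c w') = if w = w' then u b c else 0 := by
  simp only [applyOne, Option.forall, withBit_none, withBit_some]
  by_cases h : w = w'
  · simp [h]
  · rw [if_neg h, if_neg]
    intro h'
    exact h (funext fun q => h'.2 q (by simp))

theorem controlled_withBit (U : Op Q) (b c : Bool) (w w' : Basis Q) :
    controlled U (withBit b w) (withBit c w') =
      if b = c then (if b then U else 1) w w' else 0 := by
  rw [controlled_eq_block]
  rfl

theorem hadamardTest_withBit (U : Op Q) (j : ℕ) (w : Basis Q) :
    hadamardTest U j (withBit false w) (withBit false (zeroState Q)) =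
      ((1 : Op Q) w (zeroState Q) + Complex.I ^ j * U w (zeroState Q)) / 2 := by
  have h2 : ((√2 : ℝ) : ℂ)⁻¹ * ((√2 : ℝ) : ℂ)⁻¹ = 1 / 2 := by
    rw [← mul_inv, ← Complex.ofReal_mul, Real.mul_self_sqrt (by norm_num)]
    norm_num
  have hS : gateS ^ j = Matrix.diagonal fun a => if a = true then Complex.I ^ j else 1 := by
    rw [gateS, Matrix.diagonal_pow]
    congr 1
    funext a
    cases a <;> simp
  rw [hadamardTest, mul_assoc, mul_assoc]
  simp only [Matrix.mul_apply, sum_withBit, applyOne_none_withBit, controlled_withBit, ite_mul,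
    zero_mul, mul_ite, mul_zero, Finset.sum_ite_eq, Finset.sum_ite_eq', Finset.mem_univ, if_true,
    Fintype.sum_bool, hS]
  simp [gateH]
  linear_combination ((1 : Op Q) w (zeroState Q) + Complex.I ^ j * U w (zeroState Q)) * h2

/-- The amplitudes on outcome `0` form the vector (|0ⁿ⟩ + iʲU|0ⁿ⟩)/2. Both summands are unit
vectors, so the squared norm is (2 + 2 Re iʲ⟨0ⁿ|U|0ⁿ⟩)/4. -/
theorem probZero_hadamardTest {U : Op Q} (hU : U * star U = 1) (j : ℕ) :
    probZero (hadamardTest U j) =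
      (1 + (Complex.I ^ j * U (zeroState Q) (zeroState Q)).re) / 2 := by
  have hz : zeroState (Option Q) = withBit false (zeroState Q) := by
    funext r
    cases r <;> rfl
  have hcol : ∑ w, Complex.normSq (U w (zeroState Q)) = 1 := by
    have hU' : star U * U = 1 := mul_eq_one_comm.1 hU
    have h := congrFun (congrFun hU' (zeroState Q)) (zeroState Q)
    rw [Matrix.mul_apply, Matrix.one_apply_eq] at h
    simp only [Matrix.star_apply, Complex.star_def, ← Complex.normSq_eq_conj_mul_self] at h
    exact_mod_cast h
  have hI : Complex.normSq (Complex.I ^ j) = 1 := by simp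
  rw [probZero, sum_withBit, Fintype.sum_bool]
  simp only [withBit_none, hz, hadamardTest_withBit]
  simp only [Bool.true_eq_false, if_false, Finset.sum_const_zero, zero_add, if_true,
    ← Complex.normSq_eq_norm_sq, Complex.normSq_div, Complex.normSq_add, Complex.normSq_mul, hI,
    one_mul]
  rw [← Finset.sum_div, Finset.sum_add_distrib, Finset.sum_add_distrib, hcol,
    Finset.sum_eq_single (zeroState Q), Finset.sum_eq_single (zeroState Q)]
  · rw [Matrix.one_apply_eq, one_mul, Complex.conj_re, map_one,
      show Complex.normSq 2 = 4 by norm_num [Complex.normSq_apply]]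
    ring
  · intro w _ hw
    simp [Matrix.one_apply_ne hw]
  · simp
  · intro w _ hw
    simp [Matrix.one_apply_ne hw]
  · simp

end HadamardTest

end QCircuit

theorem mainTheorem6 :
    ∃ K : ℕ, ∀ (l₁ l₂ d : ℕ) (v : Fin l₁ × Fin l₂) (C : QCircuit.Circuit (Fin l₁ × Fin l₂)),
      C.depth = d →
      (∃ W : QCircuit.Circuit (Option (Fin l₁ × Fin l₂)),
        W.Under (QCircuit.withControl (QCircuit.lattice l₁ l₂) v) ∧
        W.depth ≤ K * (d * (l₁ + l₂)) ∧
        W.op = QCircuit.controlled C.op) ∧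
      (1 ≤ d →
        (∃ W₀ : QCircuit.Circuit (Option (Fin l₁ × Fin l₂)),
          W₀.Under (QCircuit.withControl (QCircuit.lattice l₁ l₂) v) ∧
          W₀.depth ≤ K * (d * (l₁ + l₂)) ∧
          W₀.op = QCircuit.hadamardTest C.op 0 ∧
          QCircuit.probZero W₀.op =
            (1 + (C.op (QCircuit.zeroState _) (QCircuit.zeroState _)).re) / 2) ∧
        (∃ W₁ : QCircuit.Circuit (Option (Fin l₁ × Fin l₂)),
          W₁.Under (QCircuit.withControl (QCircuit.lattice l₁ l₂) v) ∧
          W₁.depth ≤ K * (d * (l₁ + l₂)) ∧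
          W₁.op = QCircuit.hadamardTest C.op 1 ∧
          QCircuit.probZero W₁.op =
            (1 - (C.op (QCircuit.zeroState _) (QCircuit.zeroState _)).im) / 2)) := by
  -- The controlled circuit needs 34; the three one-qubit gates of the test are absorbed by 3 · d(l₁
  -- + l₂), which is where `1 ≤ d` enters.
  refine ⟨37, ?_⟩
  rintro l₁ l₂ d v C rfl
  have h := QCircuit.implements_controlled_circuit v C
  have hW := C.op_mul_star
  have hd : C.depth * (34 * (l₁ + l₂)) = 34 * (C.depth * (l₁ + l₂)) := by ring
  have hl : 1 ≤ l₁ + l₂ := by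
    have := v.1.pos
    omega
  refine ⟨h.mono (by omega), fun h1 => ?_⟩
  have hdl : 1 ≤ C.depth * (l₁ + l₂) := Nat.mul_pos h1 hl
  constructor
  · obtain ⟨W, hW1, hW2, hW3⟩ := (h.hadamardTest 0).mono
      (show _ ≤ 37 * (C.depth * (l₁ + l₂)) by omega)
    refine ⟨W, hW1, hW2, hW3, ?_⟩
    rw [hW3, QCircuit.probZero_hadamardTest hW, pow_zero, one_mul]
  · obtain ⟨W, hW1, hW2, hW3⟩ := (h.hadamardTest 1).mono
      (show _ ≤ 37 * (C.depth * (l₁ + l₂)) by omega)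
    refine ⟨W, hW1, hW2, hW3, ?_⟩
    rw [hW3, QCircuit.probZero_hadamardTest hW, pow_one, Complex.I_mul_re, ← sub_eq_add_neg]
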